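/- Consider the problem of minimizing $f_0(x)$ over $x\in\mathbb R^n$ subject to $f_j(x)\le 0$, $j\in I=\{1,\dots,m\}$, with $f_0,f_1,\dots,f_m:\mathbb R^n\to\mathbb R$. Write $g_j=\nabla f_j$, $\varphi(x)=\max\{0,f_1(x),\dots,f_m(x)\}$, $\bar f_j(x)=f_j(x)$ if $f_j(x)\le 0$ and $\bar f_j(x)=f_j(x)-\varphi(x)$ if $f_j(x)>0$, and $L(x,\lambda)=f_0(x)+\sum_{j\in I}\lambda_jf_j(x)$. **Algorithm.** Parameters: $\gamma,\eta,\varepsilon\in(0,1)$, $0<\theta<\sigma<1$, $0<\varrho<\sigma$, $\xi,\zeta>0$, $\alpha\in(0,\frac12)$, $\rho>1$, $\delta>2$, $\tau\in(2,3)$. Data: $x^0\in\mathbb R^n$ and a symmetric positive definite matrix $B_0$. Iteration $k$, with $\varphi_k=\varphi(x^k)$, is as follows. *Step 1.* Let $d_0^k$ minimize $g_0(x^k)^Td+\frac12d^TB_kd$ subject to $\bar f_j(x^k)+g_j(x^k)^Td\le0$ for all $j\in I$, and let $\lambda^k$ be a corresponding KKT multiplier vector. If $d_0^k=0$ and $\varphi_k=0$,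 stop. *Step 2.* Let $N_k=(g_1(x^k),\dots,g_m(x^k))$, $D^k=\mathrm{diag}(D^k_j)$ with $D_j^k=|\bar f_j(x^k)|\,(|\bar f_j(x^k)+g_j(x^k)^Td_0^k|+\|d_0^k\|)$, and $V_k=\begin{pmatrix}B_k&N_k\\N_k^T&-D^k\end{pmatrix}$. Solve $V_k\binom{d_1^k}{h_1^k}=\binom{0}{r}$ with $r_j=-\|d_0^k\|^\tau-\varphi_k^\sigma-\big(f_j(x^k+d_0^k)-f_j(x^k)-g_j(x^k)^Td_0^k\big)$, and put $d^k=d_0^k+d_1^k$. If $g_0(x^k)^Td_0^k\le\zeta\min\{-\|d_0^k\|^\delta,-\|d^k\|^\delta\}+\xi\varphi_k^\varrho$, go to Step 3; otherwise go to Step 4. *Step 3.* Let $t_k$ be the first $t$ in $1,\frac12,\frac14,\dots$ such that $$\left\{\begin{array}{ll}f_0(x^k+td^k)\le f_0(x^k)+\alpha t\,g_0(x^k)^Td_0^k+\rho(1-\alpha)t\varphi_k^\theta,&\\ f_j(x^k+td^k)\le\varphi_k-\alpha t(\|d_0^k\|^\tau+\varphi_k^\sigma)&\text{for all } j \text{ with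 } f_j(x^k)>0,\\ f_j(x^k+td^k)\le0&\text{for all } j\text{ with } f_j(x^k)\le0,\end{array}\right.\tag{14}$$ and go to Step 6; if no such $t\ge\varepsilon$ exists, go to Step 4. *Step 4.* Solve $V_k\binom{\tilde d^k}{\tilde h^k}=\binom{0}{s}$ with $s_j=-(\|d_0^k\|+\varphi_k^\sigma)$, and set $q^k=(1-\beta_k)d_0^k+\beta_k\tilde d^k$, where $\beta_k=\min\big\{1,\frac{(\theta-1)g_0(x^k)^Td_0^k+\varphi_k^\theta}{g_0(x^k)^T\tilde d^k-g_0(x^k)^Td_0^k}\big\}$ if $g_0(x^k)^T\tilde d^k>g_0(x^k)^Td_0^k$, and $\beta_k=1$ otherwise. *Step 5.* Let $t_k$ be the first $t$ in $1,\eta,\eta^2,\dots$ with $f_0(x^k+tq^k)\le f_0(x^k)+\gamma t\,g_0(x^k)^Tq^k+\rho(1-\gamma)t\varphi_k^\theta$, with $f_j(x^k+tq^k)\le\varphi_k-\gamma t\beta_k(\|d_0^k\|+\varphi_k^\sigma)$ whenever $f_j(x^k)>0$, and with $f_j(x^k+tq^k)\le0$ whenever $f_j(x^k)\le0$; then replace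 $d^k$ by $q^k$. *Step 6.* Choose a symmetric positive definite matrix $B_{k+1}$ (in any way), set $x^{k+1}=x^k+t_kd^k$, and return to Step 1 with $k+1$. **Theorem.** Suppose that the algorithm generates an infinite sequence $\{x^k\}$, and that: 1. for each $x\in\mathbb R^n$ the vectors $g_j(x)$ with $\bar f_j(x)=0$ are linearly independent; 2. there are constants $a,b>0$ with $a\|d\|^2\le d^TB_kd\le b\|d\|^2$ for all $d\in\mathbb R^n$ and all $k$; 3. $f_0,f_1,\dots,f_m$ are twice continuously differentiable, $\{x^k\}$ is bounded, and it has an accumulation point $x^*$ such that the KKT pair $(x^*,\lambda^*)$ of the problem satisfies the strong second-order sufficient condition: $d^T\nabla^2_{xx}L(x^*,\lambda^*)d>0$ for all $d\ne0$ with $g_j(x^*)^Td=0$ for every $j$ with $\lambda^*_j>0$; 4. $\|(\nabla^2_{xx}L(x^*,\lambda^*)-B_k)d_0^k\|=o(\|d_0^k\|)$ as $k\to\infty$. (Strict complementarity is not assumed.) Then for all sufficiently large $k$ the conditions (14), with $d^k=d_0^k+d_1^k$, hold for $t=1$. Moreover, for all sufficiently large $k$ the algorithm performs exactly Steps 1,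 2, 3, 6 (cycle I): Steps 4 and 5 are not performed, $t_k=1$ and $x^{k+1}=x^k+d_0^k+d_1^k$, so that the Maratos effect does not occur, and each such iteration solves one quadratic program and one system of linear equations. -/

import Mathlib

open Filter Topology

noncomputable section

/-- The problem: minimize `obj x` subject to `con j x ≤ 0` for `j = 1, …, m`, over `x ∈ ℝⁿ`. -/
structure NLProblem (n m : ℕ) where
  obj : EuclideanSpace ℝ (Fin n) → ℝ
  con : Fin m → EuclideanSpace ℝ (Fin n) → ℝ

/-- The product `B d` of a matrix and a vector of `ℝⁿ`. -/
def matVec {n : ℕ} (B : Matrix (Fin n) (Fin n) ℝ) (d : EuclideanSpace ℝ (Fin n)) :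
    EuclideanSpace ℝ (Fin n) :=
  Matrix.toEuclideanLin B d

namespace NLProblem

variable {n m : ℕ} (P : NLProblem n m)

/-- Gradient of the objective. -/
def g0 (x : EuclideanSpace ℝ (Fin n)) : EuclideanSpace ℝ (Fin n) := gradient P.obj x

/-- Gradient of the `j`-th constraint function. -/
def g (j : Fin m) (x : EuclideanSpace ℝ (Fin n)) : EuclideanSpace ℝ (Fin n) :=
  gradient (P.con j) x

/-- `φ(x) = max {0, f₁(x), …, f_m(x)}`. -/
def phi (x : EuclideanSpace ℝ (Fin n)) : ℝ :=
  Finset.univ.fold max 0 (fun j => P.con j x)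

/-- `f̄_j(x) = f_j(x)` if `f_j(x) ≤ 0`, and `f_j(x) - φ(x)` otherwise. -/
def fbar (j : Fin m) (x : EuclideanSpace ℝ (Fin n)) : ℝ :=
  if P.con j x ≤ 0 then P.con j x else P.con j x - P.phi x

/-- For every `x ∈ ℝⁿ` the gradients `g_j(x)` with `f̄_j(x) = 0` are linearly independent. -/
def GradientsIndependent : Prop :=
  ∀ x, LinearIndepOn ℝ (fun j => P.g j x) {j | P.fbar j x = 0}

/-- The Lagrangian `L(x, lam) = f₀(x) + ∑ⱼ lamⱼ fⱼ(x)`. -/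
def lagrangian (lam : Fin m → ℝ) (x : EuclideanSpace ℝ (Fin n)) : ℝ :=
  P.obj x + ∑ j, lam j * P.con j x

/-- The Hessian `∇²ₓₓ L(x, lam)`, as the derivative of the gradient. -/
def hessL (x : EuclideanSpace ℝ (Fin n)) (lam : Fin m → ℝ) :
    EuclideanSpace ℝ (Fin n) →L[ℝ] EuclideanSpace ℝ (Fin n) :=
  fderiv ℝ (gradient (P.lagrangian lam)) x

/-- `(x, lam)` is a Karush-Kuhn-Tucker pair of the problem. -/
structure IsKKTPair (x : EuclideanSpace ℝ (Fin n)) (lam : Fin m → ℝ) : Prop where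
  stationary : P.g0 x + ∑ j, lam j • P.g j x = 0
  feasible : ∀ j, P.con j x ≤ 0
  nonneg : ∀ j, 0 ≤ lam j
  complementary : ∀ j, lam j * P.con j x = 0

/-- Strong second-order sufficient condition: `dᵀ ∇²L(x, lam) d > 0` for all `d ≠ 0` with
`g_j(x)ᵀ d = 0` whenever `lam j > 0`. -/
def StrongSecondOrder (x : EuclideanSpace ℝ (Fin n)) (lam : Fin m → ℝ) : Prop :=
  ∀ d : EuclideanSpace ℝ (Fin n), d ≠ 0 → (∀ j, 0 < lam j → inner ℝ (P.g j x) d = 0) →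
    0 < inner ℝ d (P.hessL x lam d)

/-! ### The quadratic program and the linear systems -/

/-- Feasibility of `d` for the quadratic program at `x`. -/
def QPFeasible (x d : EuclideanSpace ℝ (Fin n)) : Prop :=
  ∀ j, P.fbar j x + inner ℝ (P.g j x) d ≤ 0

/-- Objective `g₀(x)ᵀ d + ½ dᵀ B d` of the quadratic program. -/
def qpObj (x : EuclideanSpace ℝ (Fin n)) (B : Matrix (Fin n) (Fin n) ℝ)
    (d : EuclideanSpace ℝ (Fin n)) : ℝ :=
  inner ℝ (P.g0 x) d + 1 / 2 * inner ℝ d (matVec B d)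

/-- `d` is an optimal solution of the quadratic program. -/
def IsQPSolution (x : EuclideanSpace ℝ (Fin n)) (B : Matrix (Fin n) (Fin n) ℝ)
    (d : EuclideanSpace ℝ (Fin n)) : Prop :=
  P.QPFeasible x d ∧ ∀ d', P.QPFeasible x d' → P.qpObj x B d ≤ P.qpObj x B d'

/-- `lam` is a KKT multiplier vector of the quadratic program at its solution `d`. -/
structure IsQPMultiplier (x : EuclideanSpace ℝ (Fin n)) (B : Matrix (Fin n) (Fin n) ℝ)
    (d : EuclideanSpace ℝ (Fin n)) (lam : Fin m → ℝ) : Prop where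
  stationary : P.g0 x + matVec B d + ∑ j, lam j • P.g j x = 0
  nonneg : ∀ j, 0 ≤ lam j
  complementary : ∀ j, lam j * (P.fbar j x + inner ℝ (P.g j x) d) = 0

/-- The matrix `N = (g₁(x), …, g_m(x))`, whose columns are the constraint gradients. -/
def gradMatrix (x : EuclideanSpace ℝ (Fin n)) : Matrix (Fin n) (Fin m) ℝ :=
  Matrix.of fun i j => P.g j x i

/-- `D_j = |f̄_j(x)| (|f̄_j(x) + g_j(x)ᵀ d₀| + ‖d₀‖)`. -/
def diagD (x d0 : EuclideanSpace ℝ (Fin n)) (j : Fin m) : ℝ :=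
  |P.fbar j x| * (|P.fbar j x + inner ℝ (P.g j x) d0| + ‖d0‖)

/-- The common coefficient matrix `V = [[B, N], [Nᵀ, -D]]` of the linear systems. -/
def coeffV (x : EuclideanSpace ℝ (Fin n)) (B : Matrix (Fin n) (Fin n) ℝ)
    (d0 : EuclideanSpace ℝ (Fin n)) : Matrix (Fin n ⊕ Fin m) (Fin n ⊕ Fin m) ℝ :=
  Matrix.fromBlocks B (P.gradMatrix x) (P.gradMatrix x).transpose
    (-Matrix.diagonal (P.diagD x d0))

/-- `(d, h)` solves the linear system `V (d, h) = (0, r)`. -/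
def SolvesSLE (x : EuclideanSpace ℝ (Fin n)) (B : Matrix (Fin n) (Fin n) ℝ)
    (d0 : EuclideanSpace ℝ (Fin n)) (r : Fin m → ℝ)
    (d : EuclideanSpace ℝ (Fin n)) (h : Fin m → ℝ) : Prop :=
  (P.coeffV x B d0).mulVec (Sum.elim (fun i => d i) h) = Sum.elim (fun _ => 0) r

end NLProblem

/-- The parameters of the algorithm, with their admissible ranges. -/
structure AlgParams where
  (gamma eta eps theta sigma varrho xi zeta alpha rho delta tau : ℝ)
  gamma_mem : gamma ∈ Set.Ioo (0 : ℝ) 1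
  eta_mem : eta ∈ Set.Ioo (0 : ℝ) 1
  eps_mem : eps ∈ Set.Ioo (0 : ℝ) 1
  theta_pos : 0 < theta
  theta_lt_sigma : theta < sigma
  sigma_lt_one : sigma < 1
  varrho_pos : 0 < varrho
  varrho_lt_sigma : varrho < sigma
  xi_pos : 0 < xi
  zeta_pos : 0 < zeta
  alpha_mem : alpha ∈ Set.Ioo (0 : ℝ) (1 / 2)
  one_lt_rho : 1 < rho
  two_lt_delta : 2 < delta
  tau_mem : tau ∈ Set.Ioo (2 : ℝ) 3

namespace NLProblem

variable {n m : ℕ} (P : NLProblem n m) (A : AlgParams)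

/-- Right-hand side (lower block) of the system for the higher-order correction `d₁`:
`-(‖d₀‖^τ + φ(x)^σ) - (f_j(x + d₀) - f_j(x) - g_j(x)ᵀ d₀)`. -/
def rhsCorrection (x d0 : EuclideanSpace ℝ (Fin n)) (j : Fin m) : ℝ :=
  -(‖d0‖ ^ A.tau + P.phi x ^ A.sigma)
    - (P.con j (x + d0) - P.con j x - inner ℝ (P.g j x) d0)

/-- Right-hand side (lower block) of the system for `d̃`: `-(‖d₀‖ + φ(x)^σ)`. -/
def rhsTilde (x d0 : EuclideanSpace ℝ (Fin n)) (_ : Fin m) : ℝ :=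
  -(‖d0‖ + P.phi x ^ A.sigma)

/-- The test of Step 2:
`g₀(x)ᵀ d₀ ≤ ζ min {-‖d₀‖^δ, -‖d‖^δ} + ξ φ(x)^ϱ`. -/
def Step2Test (x d0 d : EuclideanSpace ℝ (Fin n)) : Prop :=
  inner ℝ (P.g0 x) d0 ≤
    A.zeta * min (-(‖d0‖ ^ A.delta)) (-(‖d‖ ^ A.delta)) + A.xi * P.phi x ^ A.varrho

/-- The line-search conditions of Step 3 at `x`, with direction `d` and trial step `t`. -/
structure Step3Conditions (x d0 d : EuclideanSpace ℝ (Fin n)) (t : ℝ) : Prop where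
  objective : P.obj (x + t • d) ≤
    P.obj x + A.alpha * t * inner ℝ (P.g0 x) d0 + A.rho * (1 - A.alpha) * t * P.phi x ^ A.theta
  violated : ∀ j, 0 < P.con j x →
    P.con j (x + t • d) ≤ P.phi x - A.alpha * t * (‖d0‖ ^ A.tau + P.phi x ^ A.sigma)
  satisfied : ∀ j, P.con j x ≤ 0 → P.con j (x + t • d) ≤ 0

/-- Step 3 succeeds with steplength `t`: `t` is the first element of `1, 1/2, 1/4, …` that
satisfies the line-search conditions, and it is not smaller than `ε`. -/
def Step3Succeeds (x d0 d : EuclideanSpace ℝ (Fin n)) (t : ℝ) : Prop :=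
  ∃ i : ℕ, t = (1 / 2 : ℝ) ^ i ∧ A.eps ≤ t ∧ P.Step3Conditions A x d0 d t ∧
    ∀ i' < i, ¬ P.Step3Conditions A x d0 d ((1 / 2 : ℝ) ^ i')

/-- Step 3 fails: no element `t ≥ ε` of `1, 1/2, 1/4, …` satisfies the conditions. -/
def Step3Fails (x d0 d : EuclideanSpace ℝ (Fin n)) : Prop :=
  ∀ i : ℕ, A.eps ≤ (1 / 2 : ℝ) ^ i → ¬ P.Step3Conditions A x d0 d ((1 / 2 : ℝ) ^ i)

/-- The weight `β` of the convex combination in Step 4. -/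
def beta (x d0 dt : EuclideanSpace ℝ (Fin n)) : ℝ :=
  if inner ℝ (P.g0 x) d0 < inner ℝ (P.g0 x) dt then
    min 1 (((A.theta - 1) * inner ℝ (P.g0 x) d0 + P.phi x ^ A.theta) /
      (inner ℝ (P.g0 x) dt - inner ℝ (P.g0 x) d0))
  else 1

/-- The line-search conditions of Step 5 at `x`, with direction `q`, weight `b`, step `t`. -/
structure Step5Conditions (x d0 q : EuclideanSpace ℝ (Fin n)) (b t : ℝ) : Prop where
  objective : P.obj (x + t • q) ≤
    P.obj x + A.gamma * t * inner ℝ (P.g0 x) q + A.rho * (1 - A.gamma) * t * P.phi x ^ A.theta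
  violated : ∀ j, 0 < P.con j x →
    P.con j (x + t • q) ≤ P.phi x - A.gamma * t * b * (‖d0‖ + P.phi x ^ A.sigma)
  satisfied : ∀ j, P.con j x ≤ 0 → P.con j (x + t • q) ≤ 0

/-- Steps 4 and 5 produce the direction `q` and the steplength `t`. -/
def Steps45 (x : EuclideanSpace ℝ (Fin n)) (B : Matrix (Fin n) (Fin n) ℝ)
    (d0 q : EuclideanSpace ℝ (Fin n)) (t : ℝ) : Prop :=
  ∃ (dt : EuclideanSpace ℝ (Fin n)) (ht : Fin m → ℝ),
    P.SolvesSLE x B d0 (P.rhsTilde A x d0) dt ht ∧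
    q = (1 - P.beta A x d0 dt) • d0 + P.beta A x d0 dt • dt ∧
    ∃ i : ℕ, t = A.eta ^ i ∧ P.Step5Conditions A x d0 q (P.beta A x d0 dt) t ∧
      ∀ i' < i, ¬ P.Step5Conditions A x d0 q (P.beta A x d0 dt) (A.eta ^ i')

/-- One passage through the algorithm at `(x, B)`, after `d₀` and `d₁` have been computed in
Steps 1 and 2. The last three arguments are the list of the numbers of the steps performed,
the steplength, and the final direction. -/
inductive Iteration (x : EuclideanSpace ℝ (Fin n)) (B : Matrix (Fin n) (Fin n) ℝ)
    (d0 d1 : EuclideanSpace ℝ (Fin n)) :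
    List ℕ → ℝ → EuclideanSpace ℝ (Fin n) → Prop where
  | cycleI {t : ℝ} (test : P.Step2Test A x d0 (d0 + d1))
      (success : P.Step3Succeeds A x d0 (d0 + d1) t) :
      Iteration x B d0 d1 [1, 2, 3, 6] t (d0 + d1)
  | step3Failed {t : ℝ} {q : EuclideanSpace ℝ (Fin n)}
      (test : P.Step2Test A x d0 (d0 + d1)) (failure : P.Step3Fails A x d0 (d0 + d1))
      (steps45 : P.Steps45 A x B d0 q t) :
      Iteration x B d0 d1 [1, 2, 3, 4, 5, 6] t q
  | testFailed {t : ℝ} {q : EuclideanSpace ℝ (Fin n)}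
      (test : ¬ P.Step2Test A x d0 (d0 + d1)) (steps45 : P.Steps45 A x B d0 q t) :
      Iteration x B d0 d1 [1, 2, 4, 5, 6] t q

/-- An infinite run of the algorithm, that is, one which never stops in Step 1. The initial point
`x 0` is arbitrary and the symmetric positive definite matrices `B k` are updated in an
arbitrary way. -/
structure Run where
  x : ℕ → EuclideanSpace ℝ (Fin n)
  B : ℕ → Matrix (Fin n) (Fin n) ℝ
  d0 : ℕ → EuclideanSpace ℝ (Fin n)
  lam : ℕ → Fin m → ℝ
  d1 : ℕ → EuclideanSpace ℝ (Fin n)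
  h1 : ℕ → Fin m → ℝ
  /-- the numbers of the steps performed in iteration `k`, in order -/
  trace : ℕ → List ℕ
  /-- the steplength -/
  t : ℕ → ℝ
  /-- the direction along which the step is finally taken -/
  dir : ℕ → EuclideanSpace ℝ (Fin n)
  posDef : ∀ k, (B k).PosDef
  step1_solution : ∀ k, P.IsQPSolution (x k) (B k) (d0 k)
  step1_multiplier : ∀ k, P.IsQPMultiplier (x k) (B k) (d0 k) (lam k)
  step1_continue : ∀ k, ¬ (d0 k = 0 ∧ P.phi (x k) = 0)
  step2_correction : ∀ k,
    P.SolvesSLE (x k) (B k) (d0 k) (P.rhsCorrection A (x k) (d0 k)) (d1 k) (h1 k)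
  iteration : ∀ k, P.Iteration A (x k) (B k) (d0 k) (d1 k) (trace k) (t k) (dir k)
  step6_update : ∀ k, x (k + 1) = x k + t k • dir k

end NLProblem

/-- Number of quadratic programs solved in an iteration: one in each passage of Step 1. -/
def qpCount (trace : List ℕ) : ℕ := trace.count 1

/-- Number of linear systems solved in an iteration: one in each passage of Steps 2 and 4. -/
def sleCount (trace : List ℕ) : ℕ := trace.count 2 + trace.count 4

end

/-
The line searches make a merit potential `f₀ + K φ ^ (1 + θ - σ)` decrease by a multiple of
`t_k (‖d₀ᵏ‖² + φ_k ^ θ)`, and the steplengths cannot vanish unless the residual `‖d₀ᵏ‖² + φ_k ^ θ`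
does; hence `d₀ᵏ → 0` and `φ_k → 0`, and every accumulation point is a KKT point. The strong
second-order condition isolates `x*` among the KKT points, and since the steps tend to zero, the
whole sequence and its multipliers converge. The correction `d₁ᵏ` has size
`O(‖d₀ᵏ‖² + φ_k ^ σ)`, and its right-hand side cancels the second-order part of the constraints.
A second-order expansion of `f₀` along `d₀ᵏ + d₁ᵏ` then reproduces the quadratic model of Step 1
up to `o(‖d₀ᵏ‖² + φ_k ^ θ)`, so that `α < 1/2` and `θ < σ` leave room for the unit step.
-/

section Calculus

variable {E : Type*} [NormedAddCommGroup E] [InnerProductSpace ℝ E] [CompleteSpace E] {f : E → ℝ}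

theorem contDiff_gradient {k l : WithTop ℕ∞} (hf : ContDiff ℝ l f) (hkl : k + 1 ≤ l) :
    ContDiff ℝ k (gradient f) :=
  ((InnerProductSpace.toDual ℝ E).symm : StrongDual ℝ E ≃ₗᵢ[ℝ] E).contDiff.comp
    (hf.fderiv_right hkl)

theorem hasDerivAt_comp_add_smul {x d : E} {s : ℝ} (hf : DifferentiableAt ℝ f (x + s • d)) :
    HasDerivAt (fun s : ℝ => f (x + s • d)) (inner ℝ (gradient f (x + s • d)) d) s := by
  have hline : HasDerivAt (fun s : ℝ => x + s • d) d s := by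
    simpa using ((hasDerivAt_id s).smul_const d).const_add x
  exact (hf.hasGradientAt.hasFDerivAt.comp_hasDerivAt s hline).congr_deriv (by simp)

theorem abs_taylor_remainder_le (hf : Differentiable ℝ f) (x d : E) (H : E →L[ℝ] E) {C : ℝ}
    (hC : ∀ s ∈ Set.Icc (0 : ℝ) 1, ‖gradient f (x + s • d) - gradient f x - s • H d‖ ≤ C) :
    |f (x + d) - f x - inner ℝ (gradient f x) d - 1 / 2 * inner ℝ d (H d)| ≤ C * ‖d‖ := by
  have hderiv : ∀ s ∈ Set.Icc (0 : ℝ) 1, HasDerivWithinAt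
      (fun s : ℝ => f (x + s • d) - s * inner ℝ (gradient f x) d
        - s ^ 2 * (1 / 2 * inner ℝ d (H d)))
      (inner ℝ (gradient f (x + s • d) - gradient f x - s • H d) d) (Set.Icc 0 1) s := by
    intro s _
    refine ((((hasDerivAt_comp_add_smul (hf _)).sub
      ((hasDerivAt_id s).mul_const (inner ℝ (gradient f x) d))).sub
      ((hasDerivAt_pow 2 s).mul_const (1 / 2 * inner ℝ d (H d)))).congr_deriv ?_).hasDerivWithinAt
    simp only [inner_sub_left, real_inner_smul_left, real_inner_comm d (H d)]
    norm_num
    ring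
  have hbound : ∀ s ∈ Set.Icc (0 : ℝ) 1,
      ‖inner ℝ (gradient f (x + s • d) - gradient f x - s • H d) d‖ ≤ C * ‖d‖ := fun s hs =>
    (norm_inner_le_norm _ _).trans (mul_le_mul_of_nonneg_right (hC s hs) (norm_nonneg _))
  have hmean := (convex_Icc (0 : ℝ) 1).norm_image_sub_le_of_norm_hasDerivWithin_le hderiv hbound
    (Set.left_mem_Icc.2 zero_le_one) (Set.right_mem_Icc.2 zero_le_one)
  simp only [Real.norm_eq_abs, one_smul, zero_smul, add_zero, sub_zero, one_mul, zero_mul,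
    one_pow, abs_one, mul_one, ne_eq, OfNat.ofNat_ne_zero, not_false_eq_true, zero_pow] at hmean
  convert hmean using 2
  ring

theorem exists_taylor_bound_of_isCompact (hf : ContDiff ℝ 2 f) {K : Set E} (hK : IsCompact K)
    (hconv : Convex ℝ K) : ∃ C, 0 ≤ C ∧ ∀ x d : E, x ∈ K → x + d ∈ K →
      ‖gradient f (x + d) - gradient f x‖ ≤ C * ‖d‖ ∧
      |f (x + d) - f x - inner ℝ (gradient f x) d| ≤ C * ‖d‖ ^ 2 := by
  obtain ⟨C, hC⟩ := ((contDiff_gradient hf (k := 1) (by norm_num)).locallyLipschitz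
    ).locallyLipschitzOn.exists_lipschitzOnWith_of_compact hK
  have hlip : ∀ x d : E, x ∈ K → x + d ∈ K → ‖gradient f (x + d) - gradient f x‖ ≤ C * ‖d‖ :=
    fun x d hx hy => by simpa using hC.norm_sub_le hy hx
  refine ⟨C, C.coe_nonneg, fun x d hx hy => ⟨hlip x d hx hy, ?_⟩⟩
  have hgrad : ∀ s ∈ Set.Icc (0 : ℝ) 1,
      ‖gradient f (x + s • d) - gradient f x - s • (0 : E →L[ℝ] E) d‖ ≤ C * ‖d‖ := by
    intro s hs
    have hmem : x + s • d ∈ K := hconv.add_smul_mem hx hy hs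
    calc ‖gradient f (x + s • d) - gradient f x - s • (0 : E →L[ℝ] E) d‖
        ≤ C * ‖s • d‖ := by simpa using hlip x (s • d) hx hmem
      _ ≤ C * ‖d‖ := by
        rw [norm_smul, Real.norm_of_nonneg hs.1]
        exact mul_le_mul_of_nonneg_left (mul_le_of_le_one_left (norm_nonneg _) hs.2) C.coe_nonneg
  simpa [sq, mul_assoc] using
    abs_taylor_remainder_le (hf.differentiable (by norm_num)) x d 0 hgrad

-- The Hessian is frozen at `z` while the base point of the expansion varies.
theorem isLittleO_taylor_remainder (hf : ContDiff ℝ 2 f) (z : E) :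
    (fun p : E × E => f (p.1 + p.2) - f p.1 - inner ℝ (gradient f p.1) p.2
      - 1 / 2 * inner ℝ p.2 (fderiv ℝ (gradient f) z p.2)) =o[𝓝 (z, 0)]
      fun p : E × E => ‖p.2‖ ^ 2 := by
  have hstrict : HasStrictFDerivAt (gradient f) (fderiv ℝ (gradient f) z) z :=
    (contDiff_gradient hf (k := 1) (by norm_num)).contDiffAt.hasStrictFDerivAt (by norm_num)
  refine Asymptotics.isLittleO_iff.2 fun ε hε => ?_
  obtain ⟨r, hr, hgrad⟩ := Metric.eventually_nhds_iff.1 (hstrict.isLittleO.def hε)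
  refine Metric.eventually_nhds_iff.2 ⟨r / 2, by positivity, ?_⟩
  rintro ⟨x, d⟩ hxd
  obtain ⟨hx, hd⟩ : ‖x - z‖ < r / 2 ∧ ‖d‖ < r / 2 := by
    simpa [Prod.dist_eq, max_lt_iff, dist_eq_norm] using hxd
  have hbound : ∀ s ∈ Set.Icc (0 : ℝ) 1, ‖gradient f (x + s • d) - gradient f x
      - s • fderiv ℝ (gradient f) z d‖ ≤ ε * ‖d‖ := by
    intro s hs
    have hsd : ‖s • d‖ ≤ ‖d‖ := by
      rw [norm_smul, Real.norm_of_nonneg hs.1]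
      exact mul_le_of_le_one_left (norm_nonneg _) hs.2
    have hnear : dist ((x + s • d, x) : E × E) (z, z) < r := by
      rw [Prod.dist_eq, max_lt_iff, dist_eq_norm, dist_eq_norm, add_sub_right_comm]
      exact ⟨(norm_add_le _ _).trans_lt (by linarith), by dsimp only; linarith⟩
    have hdiff := hgrad hnear
    simp only [add_sub_cancel_left, map_smul] at hdiff
    exact hdiff.trans (mul_le_mul_of_nonneg_left hsd hε.le)
  simpa [sq, mul_assoc] using
    abs_taylor_remainder_le (hf.differentiable (by norm_num)) x d _ hbound

end Calculus

section Compactness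

theorem exists_pos_mul_sq_norm_le {X E : Type*} [TopologicalSpace X] [NormedAddCommGroup E]
    [NormedSpace ℝ E] [ProperSpace E] {S : Set X} (hS : IsCompact S) {F : X × E → ℝ}
    (hF : ContinuousOn F (S ×ˢ Metric.sphere 0 1))
    (hsmul : ∀ x ∈ S, ∀ (t : ℝ) (v : E), F (x, t • v) = t ^ 2 * F (x, v))
    (hpos : ∀ x ∈ S, ∀ v : E, v ≠ 0 → 0 < F (x, v)) :
    ∃ c > 0, ∀ x ∈ S, ∀ v : E, c * ‖v‖ ^ 2 ≤ F (x, v) := by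
  obtain ⟨c, hc, hcF⟩ := (hS.prod (isCompact_sphere (0 : E) 1)).exists_forall_le' hF
    (a := 0) fun p hp => hpos p.1 hp.1 p.2 (ne_zero_of_mem_unit_sphere ⟨p.2, hp.2⟩)
  refine ⟨c, hc, fun x hx v => ?_⟩
  rcases eq_or_ne v 0 with rfl | hv
  · simpa using (hsmul x hx 0 0).ge
  have hv' : 0 < ‖v‖ := norm_pos_iff.2 hv
  calc c * ‖v‖ ^ 2 ≤ F (x, ‖v‖⁻¹ • v) * ‖v‖ ^ 2 := by
        gcongr
        exact hcF _ ⟨hx, by simp [norm_smul, hv'.ne']⟩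
    _ = F (x, v) := by rw [hsmul x hx]; field_simp

end Compactness

section QuadraticForm

theorem opNorm_le_of_isSymmetric {E : Type*} [NormedAddCommGroup E] [InnerProductSpace ℝ E]
    {T : E →L[ℝ] E} (hT : T.IsSymmetric) {b : ℝ} (hb : 0 ≤ b)
    (h : ∀ v, |inner ℝ (T v) v| ≤ b * ‖v‖ ^ 2) : ‖T‖ ≤ b := by
  rw [T.norm_eq_iSup_rayleighQuotient hT]
  refine ciSup_le fun v => ?_
  rw [ContinuousLinearMap.rayleighQuotient, ContinuousLinearMap.reApplyInnerSelf_apply,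
    RCLike.re_to_real, abs_div, abs_of_nonneg (sq_nonneg ‖v‖)]
  exact div_le_of_le_mul₀ (sq_nonneg _) hb (h v)

theorem norm_matVec_le {n : ℕ} {B : Matrix (Fin n) (Fin n) ℝ} (hB : B.IsHermitian) {b : ℝ}
    (hb : 0 ≤ b) (h : ∀ d : EuclideanSpace ℝ (Fin n), |inner ℝ d (matVec B d)| ≤ b * ‖d‖ ^ 2)
    (v : EuclideanSpace ℝ (Fin n)) : ‖matVec B v‖ ≤ b * ‖v‖ := by
  have hnorm : ‖(Matrix.toEuclideanLin B).toContinuousLinearMap‖ ≤ b :=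
    opNorm_le_of_isSymmetric (Matrix.isSymmetric_toEuclideanLin_iff.2 hB) hb fun v => by
      rw [real_inner_comm]
      exact h v
  exact ((Matrix.toEuclideanLin B).toContinuousLinearMap.le_opNorm v).trans
    (mul_le_mul_of_nonneg_right hnorm (norm_nonneg v))

end QuadraticForm

namespace NLProblem

section Constraints

variable {n m : ℕ} {P : NLProblem n m}

theorem phi_le_iff {x : EuclideanSpace ℝ (Fin n)} {c : ℝ} :
    P.phi x ≤ c ↔ 0 ≤ c ∧ ∀ j, P.con j x ≤ c := by
  simp [phi, Finset.fold_max_le]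

theorem phi_nonneg (x : EuclideanSpace ℝ (Fin n)) : 0 ≤ P.phi x := (phi_le_iff.1 le_rfl).1

theorem con_le_phi (j : Fin m) (x : EuclideanSpace ℝ (Fin n)) : P.con j x ≤ P.phi x :=
  (phi_le_iff.1 le_rfl).2 j

theorem rpow_phi_nonneg (x : EuclideanSpace ℝ (Fin n)) (s : ℝ) : 0 ≤ P.phi x ^ s :=
  Real.rpow_nonneg (phi_nonneg x) s

theorem continuous_phi (hf : ∀ j, Continuous (P.con j)) : Continuous P.phi := by
  suffices ∀ s : Finset (Fin m), Continuous fun x => s.fold max 0 (fun j => P.con j x) from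
    this Finset.univ
  intro s
  induction s using Finset.induction_on with
  | empty => simpa using continuous_const
  | insert j s hj ih =>
    simp only [Finset.fold_insert hj]
    exact (hf j).max ih

theorem fbar_nonpos (j : Fin m) (x : EuclideanSpace ℝ (Fin n)) : P.fbar j x ≤ 0 := by
  unfold fbar
  split_ifs with h
  · exact h
  · exact sub_nonpos.2 (con_le_phi j x)

theorem abs_fbar_sub_con_le (j : Fin m) (x : EuclideanSpace ℝ (Fin n)) :
    |P.fbar j x - P.con j x| ≤ P.phi x := by
  unfold fbar
  split_ifs with h
  · simpa using phi_nonneg x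
  · simp [abs_of_nonneg (phi_nonneg (P := P) x)]

theorem abs_fbar_le (j : Fin m) (x : EuclideanSpace ℝ (Fin n)) :
    |P.fbar j x| ≤ |P.con j x| + P.phi x := by
  have := abs_add_le (P.fbar j x - P.con j x) (P.con j x)
  rw [sub_add_cancel] at this
  linarith [abs_fbar_sub_con_le (P := P) j x]

theorem continuous_g0 (hobj : ContDiff ℝ 2 P.obj) : Continuous P.g0 :=
  (contDiff_gradient hobj (k := 1) (by norm_num)).continuous

theorem continuous_g (hcon : ∀ j, ContDiff ℝ 2 (P.con j)) (j : Fin m) : Continuous (P.g j) :=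
  (contDiff_gradient (hcon j) (k := 1) (by norm_num)).continuous

theorem exists_taylor_bound_closedBall (hobj : ContDiff ℝ 2 P.obj)
    (hcon : ∀ j, ContDiff ℝ 2 (P.con j)) (r : ℝ) :
    ∃ C, 0 ≤ C ∧ ∀ x d : EuclideanSpace ℝ (Fin n), ‖x‖ ≤ r → ‖x + d‖ ≤ r →
      |P.obj (x + d) - P.obj x - inner ℝ (P.g0 x) d| ≤ C * ‖d‖ ^ 2 ∧
      ∀ j, ‖P.g j (x + d) - P.g j x‖ ≤ C * ‖d‖ ∧
        |P.con j (x + d) - P.con j x - inner ℝ (P.g j x) d| ≤ C * ‖d‖ ^ 2 := by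
  have hK := isCompact_closedBall (0 : EuclideanSpace ℝ (Fin n)) r
  have hconv := convex_closedBall (0 : EuclideanSpace ℝ (Fin n)) r
  obtain ⟨C₀, hC₀, h₀⟩ := exists_taylor_bound_of_isCompact hobj hK hconv
  choose C₁ _ h₁ using fun j => exists_taylor_bound_of_isCompact (hcon j) hK hconv
  obtain ⟨C, hC⟩ := (Set.finite_range C₁).bddAbove
  have hCj : ∀ j, C₁ j ≤ max C₀ C := fun j => (hC ⟨j, rfl⟩).trans (le_max_right _ _)
  simp only [mem_closedBall_zero_iff] at h₀ h₁
  refine ⟨max C₀ C, le_max_of_le_left hC₀, fun x d hx hd => ⟨?_, fun j => ⟨?_, ?_⟩⟩⟩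
  · exact (h₀ x d hx hd).2.trans (by gcongr; exact le_max_left _ _)
  · exact (h₁ j x d hx hd).1.trans (by gcongr; exact hCj j)
  · exact (h₁ j x d hx hd).2.trans (by gcongr; exact hCj j)

end Constraints

section Nondegeneracy

variable {n m : ℕ} {P : NLProblem n m}

variable (P) in
/-- A continuous minorant of `|f̄_j|` that vanishes only where `f̄_j` does; it stands in for `f̄_j`,
which is discontinuous, in compactness arguments. -/
def activityGap (j : Fin m) (x : EuclideanSpace ℝ (Fin n)) : ℝ :=
  min |P.con j x| |P.con j x - P.phi x|

theorem activityGap_nonneg (j : Fin m) (x : EuclideanSpace ℝ (Fin n)) : 0 ≤ P.activityGap j x :=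
  le_min (abs_nonneg _) (abs_nonneg _)

theorem activityGap_le_abs_fbar (j : Fin m) (x : EuclideanSpace ℝ (Fin n)) :
    P.activityGap j x ≤ |P.fbar j x| := by
  unfold fbar
  split_ifs
  · exact min_le_left _ _
  · exact min_le_right _ _

theorem fbar_eq_zero_of_activityGap_eq_zero {j : Fin m} {x : EuclideanSpace ℝ (Fin n)}
    (h : P.activityGap j x = 0) : P.fbar j x = 0 := by
  have hphi := phi_nonneg (P := P) x
  unfold fbar
  rcases min_choice |P.con j x| |P.con j x - P.phi x| with hmin | hmin
  · simp [abs_eq_zero.1 (hmin.symm.trans h)]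
  · have heq := abs_eq_zero.1 (hmin.symm.trans h)
    split_ifs <;> linarith

theorem continuous_activityGap (hf : ∀ j, Continuous (P.con j)) (j : Fin m) :
    Continuous (P.activityGap j) :=
  (hf j).abs.min ((hf j).sub (continuous_phi hf)).abs

theorem GradientsIndependent.eq_zero (hindep : P.GradientsIndependent)
    {x : EuclideanSpace ℝ (Fin n)} {h : Fin m → ℝ} (hsum : ∑ j, h j • P.g j x = 0)
    (hoff : ∀ j, P.fbar j x ≠ 0 → h j = 0) : h = 0 := by
  funext j
  by_cases hj : P.fbar j x = 0
  · refine linearIndepOn_iff'.1 (hindep x) (Finset.univ.filter fun j => P.fbar j x = 0) h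
      (fun i hi => by simpa using hi) ?_ j (by simpa using hj)
    rwa [Finset.sum_filter_of_ne]
    intro i _ hi
    by_contra hne
    exact hi (by rw [hoff i hne, zero_smul])
  · exact hoff j hj

theorem exists_gram_lower_bound (hg : ∀ j, Continuous (P.g j)) (hf : ∀ j, Continuous (P.con j))
    (hindep : P.GradientsIndependent) {S : Set (EuclideanSpace ℝ (Fin n))} (hS : IsCompact S) :
    ∃ c > 0, ∀ x ∈ S, ∀ h : EuclideanSpace ℝ (Fin m),
      c * ‖h‖ ^ 2 ≤ ‖∑ j, h j • P.g j x‖ ^ 2 + ∑ j, (P.fbar j x * h j) ^ 2 := by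
  let F : EuclideanSpace ℝ (Fin n) × EuclideanSpace ℝ (Fin m) → ℝ := fun p =>
    ‖∑ j, p.2 j • P.g j p.1‖ ^ 2 + ∑ j, (P.activityGap j p.1 * p.2 j) ^ 2
  have hF : Continuous F := by
    have hgap := continuous_activityGap hf
    fun_prop
  have hsmul : ∀ x ∈ S, ∀ (t : ℝ) (h : EuclideanSpace ℝ (Fin m)),
      F (x, t • h) = t ^ 2 * F (x, h) := by
    intro x _ t h
    simp only [F, PiLp.smul_apply, smul_eq_mul, mul_smul, ← Finset.smul_sum, norm_smul, mul_pow,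
      Real.norm_eq_abs, sq_abs, mul_add, Finset.mul_sum, mul_left_comm]
  have hpos : ∀ x ∈ S, ∀ h : EuclideanSpace ℝ (Fin m), h ≠ 0 → 0 < F (x, h) := by
    intro x _ h hh
    refine lt_of_le_of_ne (by positivity) fun hzero => hh ?_
    obtain ⟨hsum, hgap⟩ := (add_eq_zero_iff_of_nonneg (by positivity) (by positivity)).1 hzero.symm
    have hcoef : ∀ j, P.activityGap j x * h j = 0 := fun j => by
      simpa using (Finset.sum_eq_zero_iff_of_nonneg fun j _ => sq_nonneg _).1 hgap j (by simp)
    have heq : ⇑h = 0 := hindep.eq_zero (by simpa using hsum) fun j hj =>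
      (mul_eq_zero.1 (hcoef j)).resolve_left fun hgap0 =>
        hj (fbar_eq_zero_of_activityGap_eq_zero hgap0)
    ext j
    exact congrFun heq j
  obtain ⟨c, hc, hcF⟩ := exists_pos_mul_sq_norm_le hS hF.continuousOn hsmul hpos
  refine ⟨c, hc, fun x hx h => (hcF x hx h).trans (add_le_add_right ?_ _)⟩
  refine Finset.sum_le_sum fun j _ => sq_le_sq.2 ?_
  rw [abs_mul, abs_mul, abs_of_nonneg (activityGap_nonneg j x)]
  exact mul_le_mul_of_nonneg_right (activityGap_le_abs_fbar j x) (abs_nonneg _)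

end Nondegeneracy

section LinearSystem

variable {n m : ℕ} {P : NLProblem n m} {x d0 d : EuclideanSpace ℝ (Fin n)}
  {B : Matrix (Fin n) (Fin n) ℝ} {r y : Fin m → ℝ} {a b c G s : ℝ}

theorem SolvesSLE.stationary (h : P.SolvesSLE x B d0 r d y) :
    matVec B d + ∑ j, y j • P.g j x = 0 := by
  ext i
  have hrow := congrFun h (Sum.inl i)
  simp only [coeffV, Matrix.fromBlocks_mulVec, Sum.elim_inl] at hrow
  simp only [matVec, PiLp.add_apply, PiLp.zero_apply, WithLp.ofLp_sum, Finset.sum_apply,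
    PiLp.smul_apply, smul_eq_mul]
  rw [← hrow]
  simp [Matrix.mulVec, dotProduct, gradMatrix, Function.comp_def, mul_comm, Matrix.toLpLin_apply]

theorem SolvesSLE.linearized (h : P.SolvesSLE x B d0 r d y) (j : Fin m) :
    inner ℝ (P.g j x) d - P.diagD x d0 j * y j = r j := by
  have hrow := congrFun h (Sum.inr j)
  simp only [coeffV, Matrix.fromBlocks_mulVec, Sum.elim_inr] at hrow
  rw [← hrow]
  simp [Matrix.mulVec, dotProduct, gradMatrix, Function.comp_def, PiLp.inner_apply, mul_comm,
    Matrix.diagonal_apply, sub_eq_add_neg]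

theorem diagD_nonneg (x d0 : EuclideanSpace ℝ (Fin n)) (j : Fin m) : 0 ≤ P.diagD x d0 j := by
  unfold diagD; positivity

theorem sum_diagD_mul_sq_nonneg (x d0 : EuclideanSpace ℝ (Fin n)) (y : Fin m → ℝ) :
    0 ≤ ∑ j, P.diagD x d0 j * y j ^ 2 :=
  Finset.sum_nonneg fun j _ => mul_nonneg (diagD_nonneg x d0 j) (sq_nonneg _)

theorem sq_fbar_le_mul_diagD {j : Fin m} (hG : 1 ≤ G) (hg : ‖P.g j x‖ ≤ G) :
    P.fbar j x ^ 2 ≤ G * P.diagD x d0 j := by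
  have hinner : |inner ℝ (P.g j x) d0| ≤ G * ‖d0‖ :=
    (abs_real_inner_le_norm _ _).trans (mul_le_mul_of_nonneg_right hg (norm_nonneg _))
  have hfbar : |P.fbar j x| ≤ |P.fbar j x + inner ℝ (P.g j x) d0| + |inner ℝ (P.g j x) d0| := by
    simpa using abs_sub (P.fbar j x + inner ℝ (P.g j x) d0) (inner ℝ (P.g j x) d0)
  calc P.fbar j x ^ 2 = |P.fbar j x| * |P.fbar j x| := by rw [← sq, sq_abs]
    _ ≤ |P.fbar j x| * (G * (|P.fbar j x + inner ℝ (P.g j x) d0| + ‖d0‖)) := by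
      gcongr
      nlinarith [abs_nonneg (P.fbar j x + inner ℝ (P.g j x) d0)]
    _ = G * P.diagD x d0 j := by unfold diagD; ring

theorem SolvesSLE.energy_eq (h : P.SolvesSLE x B d0 r d y) :
    inner ℝ d (matVec B d) + ∑ j, P.diagD x d0 j * y j ^ 2 = -∑ j, y j * r j := by
  have hzero : inner ℝ d (matVec B d + ∑ j, y j • P.g j x) = 0 := by
    rw [h.stationary, inner_zero_right]
  have hcross : ∑ j, inner ℝ d (y j • P.g j x) =
      ∑ j, P.diagD x d0 j * y j ^ 2 + ∑ j, y j * r j := by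
    rw [← Finset.sum_add_distrib]
    refine Finset.sum_congr rfl fun j _ => ?_
    rw [inner_smul_right, real_inner_comm, ← h.linearized j]
    ring
  rw [inner_add_right, inner_sum] at hzero
  linarith

theorem abs_apply_le_norm_toLp (y : Fin m → ℝ) (j : Fin m) : |y j| ≤ ‖WithLp.toLp 2 y‖ :=
  PiLp.norm_apply_le (WithLp.toLp 2 y) j

theorem SolvesSLE.energy_le (h : P.SolvesSLE x B d0 r d y) (hr : ∀ j, |r j| ≤ s) :
    inner ℝ d (matVec B d) + ∑ j, P.diagD x d0 j * y j ^ 2 ≤ m * (‖WithLp.toLp 2 y‖ * s) := by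
  rw [h.energy_eq, ← Finset.sum_neg_distrib]
  calc ∑ j, -(y j * r j) ≤ ∑ _j : Fin m, ‖WithLp.toLp 2 y‖ * s := by
        refine Finset.sum_le_sum fun j _ => (neg_le_abs _).trans ?_
        rw [abs_mul]
        exact mul_le_mul (abs_apply_le_norm_toLp y j) (hr j) (abs_nonneg _) (norm_nonneg _)
    _ = m * (‖WithLp.toLp 2 y‖ * s) := by simp

/-- Quantitative nondegeneracy of the data `(x, B)` of the linear systems: a coercivity constant
`a` and a norm bound `b` for `B`, a bound `G` on the constraint gradients, and a constant `c`
measuring the independence of the gradients of the constraints with small `f̄_j`. -/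
structure IsNondegenerate (P : NLProblem n m) (x : EuclideanSpace ℝ (Fin n))
    (B : Matrix (Fin n) (Fin n) ℝ) (a b c G : ℝ) : Prop where
  coercive_pos : 0 < a
  gram_pos : 0 < c
  one_le : 1 ≤ G
  coercive : ∀ d, a * ‖d‖ ^ 2 ≤ inner ℝ d (matVec B d)
  norm_matVec_le : ∀ d, ‖matVec B d‖ ≤ b * ‖d‖
  norm_g_le : ∀ j, ‖P.g j x‖ ≤ G
  gram : ∀ h : EuclideanSpace ℝ (Fin m),
    c * ‖h‖ ^ 2 ≤ ‖∑ j, h j • P.g j x‖ ^ 2 + ∑ j, (P.fbar j x * h j) ^ 2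

namespace IsNondegenerate

theorem sq_norm_multiplier_le (H : P.IsNondegenerate x B a b c G) (h : P.SolvesSLE x B d0 r d y) :
    c * ‖WithLp.toLp 2 y‖ ^ 2 ≤
      (b ^ 2 / a + G) * (inner ℝ d (matVec B d) + ∑ j, P.diagD x d0 j * y j ^ 2) := by
  have ha := H.coercive_pos
  have hG := zero_le_one.trans H.one_le
  have hd : ‖d‖ ^ 2 ≤ inner ℝ d (matVec B d) / a :=
    (le_div_iff₀' ha).2 (H.coercive d)
  have henergy : 0 ≤ inner ℝ d (matVec B d) :=
    (by positivity : 0 ≤ a * ‖d‖ ^ 2).trans (H.coercive d)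
  have hQ := sum_diagD_mul_sq_nonneg (P := P) x d0 y
  have hgrad : ‖∑ j, y j • P.g j x‖ ^ 2 ≤ b ^ 2 / a * inner ℝ d (matVec B d) := by
    rw [eq_neg_of_add_eq_zero_right h.stationary, norm_neg]
    calc ‖matVec B d‖ ^ 2 ≤ (b * ‖d‖) ^ 2 := pow_le_pow_left₀ (norm_nonneg _) (H.norm_matVec_le d) 2
      _ = b ^ 2 * ‖d‖ ^ 2 := mul_pow _ _ _
      _ ≤ b ^ 2 * (inner ℝ d (matVec B d) / a) := by gcongr
      _ = b ^ 2 / a * inner ℝ d (matVec B d) := by ring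
  have hdiag : ∑ j, (P.fbar j x * y j) ^ 2 ≤ G * ∑ j, P.diagD x d0 j * y j ^ 2 := by
    rw [Finset.mul_sum]
    refine Finset.sum_le_sum fun j _ => ?_
    rw [mul_pow, ← mul_assoc]
    exact mul_le_mul_of_nonneg_right (sq_fbar_le_mul_diagD H.one_le (H.norm_g_le j)) (sq_nonneg _)
  have hgram := H.gram (WithLp.toLp 2 y)
  have hba : 0 ≤ b ^ 2 / a := by positivity
  linarith [mul_nonneg hba hQ, mul_nonneg hG henergy]

theorem norm_multiplier_le (H : P.IsNondegenerate x B a b c G) (h : P.SolvesSLE x B d0 r d y)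
    (hs : 0 ≤ s) (hr : ∀ j, |r j| ≤ s) :
    ‖WithLp.toLp 2 y‖ ≤ (b ^ 2 / a + G) * m / c * s := by
  have ha := H.coercive_pos
  have hc := H.gram_pos
  have hG := zero_le_one.trans H.one_le
  rcases (norm_nonneg (WithLp.toLp 2 y)).eq_or_lt with hy | hy
  · rw [← hy]
    positivity
  have hbound : ‖WithLp.toLp 2 y‖ * (c * ‖WithLp.toLp 2 y‖) ≤
      ‖WithLp.toLp 2 y‖ * ((b ^ 2 / a + G) * m * s) :=
    calc ‖WithLp.toLp 2 y‖ * (c * ‖WithLp.toLp 2 y‖) = c * ‖WithLp.toLp 2 y‖ ^ 2 := by ring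
      _ ≤ (b ^ 2 / a + G) * (m * (‖WithLp.toLp 2 y‖ * s)) :=
        (H.sq_norm_multiplier_le h).trans
          (mul_le_mul_of_nonneg_left (h.energy_le hr) (by positivity))
      _ = _ := by ring
  rw [div_mul_eq_mul_div, le_div_iff₀' hc]
  exact le_of_mul_le_mul_left hbound hy

theorem norm_solution_le (H : P.IsNondegenerate x B a b c G) (h : P.SolvesSLE x B d0 r d y)
    (hs : 0 ≤ s) (hr : ∀ j, |r j| ≤ s) :
    ‖d‖ ≤ √((b ^ 2 / a + G) * m ^ 2 / (c * a)) * s := by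
  have ha := H.coercive_pos
  have hc := H.gram_pos
  have hG := zero_le_one.trans H.one_le
  refine le_of_sq_le_sq ?_ (by positivity)
  rw [mul_pow, Real.sq_sqrt (by positivity)]
  have henergy : a * ‖d‖ ^ 2 ≤ m * (‖WithLp.toLp 2 y‖ * s) := by
    linarith [H.coercive d, h.energy_le hr, sum_diagD_mul_sq_nonneg (P := P) x d0 y]
  calc ‖d‖ ^ 2 ≤ m * (‖WithLp.toLp 2 y‖ * s) / a := (le_div_iff₀' ha).2 henergy
    _ ≤ m * (((b ^ 2 / a + G) * m / c * s) * s) / a := by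
      gcongr
      exact H.norm_multiplier_le h hs hr
    _ = _ := by field_simp

end IsNondegenerate

end LinearSystem

section BoundedRun

variable {n m : ℕ} {P : NLProblem n m} {A : AlgParams} {a b M : ℝ}
  {x d : EuclideanSpace ℝ (Fin n)} {B : Matrix (Fin n) (Fin n) ℝ} {lam : Fin m → ℝ}

theorem IsQPMultiplier.inner_g0_le (h : P.IsQPMultiplier x B d lam) :
    inner ℝ (P.g0 x) d ≤ -inner ℝ d (matVec B d) := by
  have hzero : inner ℝ d (P.g0 x + matVec B d + ∑ j, lam j • P.g j x) = 0 := by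
    rw [h.stationary, inner_zero_right]
  have hsum : 0 ≤ ∑ j, inner ℝ d (lam j • P.g j x) := by
    refine Finset.sum_nonneg fun j _ => ?_
    rw [inner_smul_right, real_inner_comm]
    linarith [h.complementary j, mul_nonneg (h.nonneg j) (neg_nonneg.2 (fbar_nonpos (P := P) j x))]
  rw [inner_add_right, inner_add_right, inner_sum, real_inner_comm] at hzero
  linarith

theorem IsQPMultiplier.norm_le (h : P.IsQPMultiplier x B d lam) (ha : 0 < a)
    (hB : a * ‖d‖ ^ 2 ≤ inner ℝ d (matVec B d)) : ‖d‖ ≤ ‖P.g0 x‖ / a := by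
  have hinner := (neg_le_abs _).trans (abs_real_inner_le_norm (P.g0 x) d)
  rcases (norm_nonneg d).eq_or_lt with hd | hd
  · rw [← hd]
    positivity
  · rw [le_div_iff₀' ha]
    refine le_of_mul_le_mul_right ?_ hd
    linarith [h.inner_g0_le, sq ‖d‖]

theorem exists_data_bound_of_isCompact (hobj : ContDiff ℝ 2 P.obj)
    (hcon : ∀ j, ContDiff ℝ 2 (P.con j)) {S : Set (EuclideanSpace ℝ (Fin n))} (hS : IsCompact S) :
    ∃ M, ∀ x ∈ S, ‖x‖ ≤ M ∧ ‖P.g0 x‖ ≤ M ∧ (∀ j, ‖P.g j x‖ ≤ M) ∧ P.phi x ≤ M ∧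
      (∀ j, |P.fbar j x| ≤ M) ∧ |P.obj x| ≤ M := by
  let F : EuclideanSpace ℝ (Fin n) → ℝ := fun x =>
    ‖x‖ + ‖P.g0 x‖ + ∑ j, ‖P.g j x‖ + P.phi x + ∑ j, |P.con j x| + |P.obj x|
  have hF : Continuous F := by
    have hg0 := continuous_g0 hobj
    have hg := continuous_g hcon
    have hc := fun j => (hcon j).continuous
    have hphi := continuous_phi hc
    have ho := hobj.continuous
    fun_prop
  obtain ⟨M, hM⟩ := hS.bddAbove_image hF.continuousOn
  refine ⟨M, fun x hx => ?_⟩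
  have hFM : F x ≤ M := hM ⟨x, hx, rfl⟩
  have hgj : ∀ j, ‖P.g j x‖ ≤ ∑ j, ‖P.g j x‖ := fun j =>
    Finset.single_le_sum (fun i _ => norm_nonneg (P.g i x)) (Finset.mem_univ j)
  have hcj : ∀ j, |P.con j x| ≤ ∑ j, |P.con j x| := fun j =>
    Finset.single_le_sum (fun i _ => abs_nonneg (P.con i x)) (Finset.mem_univ j)
  have hgsum : 0 ≤ ∑ j, ‖P.g j x‖ := by positivity
  have hcsum : 0 ≤ ∑ j, |P.con j x| := by positivity
  have hphi := phi_nonneg (P := P) x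
  have hx := norm_nonneg x
  have hg0 := norm_nonneg (P.g0 x)
  have ho := abs_nonneg (P.obj x)
  refine ⟨?_, ?_, fun j => ?_, ?_, fun j => (abs_fbar_le j x).trans ?_, ?_⟩
  · linarith
  · linarith
  · linarith [hgj j]
  · linarith
  · linarith [hcj j]
  · linarith

/-- Bounds that hold uniformly along a run: `a` bounds the matrices from below, and a single
constant `M` bounds all the data from above, including the solutions of the linear systems in terms
of their right-hand sides. -/
structure Run.Bounded (R : P.Run A) (a M : ℝ) : Prop where
  a_pos : 0 < a
  one_le : 1 ≤ M
  coercive : ∀ k d, a * ‖d‖ ^ 2 ≤ inner ℝ d (matVec (R.B k) d)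
  norm_matVec : ∀ k d, ‖matVec (R.B k) d‖ ≤ M * ‖d‖
  norm_x : ∀ k, ‖R.x k‖ ≤ M
  norm_g0 : ∀ k, ‖P.g0 (R.x k)‖ ≤ M
  norm_g : ∀ k j, ‖P.g j (R.x k)‖ ≤ M
  norm_d0 : ∀ k, ‖R.d0 k‖ ≤ M
  phi_le : ∀ k, P.phi (R.x k) ≤ M
  abs_fbar_le : ∀ k j, |P.fbar j (R.x k)| ≤ M
  abs_obj_le : ∀ k, |P.obj (R.x k)| ≤ M
  norm_solution_le : ∀ k {r d y s}, P.SolvesSLE (R.x k) (R.B k) (R.d0 k) r d y → 0 ≤ s →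
    (∀ j, |r j| ≤ s) → ‖d‖ ≤ M * s
  abs_multiplier_le : ∀ k {r d y s}, P.SolvesSLE (R.x k) (R.B k) (R.d0 k) r d y → 0 ≤ s →
    (∀ j, |r j| ≤ s) → ∀ j, |y j| ≤ M * s

theorem Run.norm_matVec_le (R : P.Run A) (ha : 0 < a) (hb : 0 ≤ b)
    (hB : ∀ (k : ℕ) (d : EuclideanSpace ℝ (Fin n)),
      a * ‖d‖ ^ 2 ≤ inner ℝ d (matVec (R.B k) d) ∧
      inner ℝ d (matVec (R.B k) d) ≤ b * ‖d‖ ^ 2) (k : ℕ) (d : EuclideanSpace ℝ (Fin n)) :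
    ‖matVec (R.B k) d‖ ≤ b * ‖d‖ :=
  _root_.norm_matVec_le (R.posDef k).isHermitian hb (fun d => by
    rw [abs_of_nonneg ((by positivity : 0 ≤ a * ‖d‖ ^ 2).trans (hB k d).1)]
    exact (hB k d).2) d

theorem Run.exists_bounded (R : P.Run A) (hindep : P.GradientsIndependent) (ha : 0 < a)
    (hb : 0 ≤ b) (hB : ∀ (k : ℕ) (d : EuclideanSpace ℝ (Fin n)),
      a * ‖d‖ ^ 2 ≤ inner ℝ d (matVec (R.B k) d) ∧
      inner ℝ d (matVec (R.B k) d) ≤ b * ‖d‖ ^ 2)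
    (hobj : ContDiff ℝ 2 P.obj) (hcon : ∀ j, ContDiff ℝ 2 (P.con j))
    (hbdd : Bornology.IsBounded (Set.range R.x)) :
    ∃ M, R.Bounded a M := by
  have hS : IsCompact (closure (Set.range R.x)) := hbdd.isCompact_closure
  have hxS : ∀ k, R.x k ∈ closure (Set.range R.x) := fun k => subset_closure ⟨k, rfl⟩
  obtain ⟨K, hK⟩ := exists_data_bound_of_isCompact hobj hcon hS
  obtain ⟨c, hc, hgram⟩ := exists_gram_lower_bound (continuous_g hcon)
    (fun j => (hcon j).continuous) hindep hS
  choose hx hg0 hg hphi hfbar hobj using fun k => hK _ (hxS k)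
  have hmatVec := R.norm_matVec_le ha hb hB
  have hnd : ∀ k, P.IsNondegenerate (R.x k) (R.B k) a b c (max 1 K) := fun k =>
    ⟨ha, hc, le_max_left _ _, fun d => (hB k d).1, hmatVec k,
      fun j => (hg k j).trans (le_max_right _ _), hgram _ (hxS k)⟩
  obtain ⟨M, hM⟩ := (List.finite_toSet [1, b, K, K / a, (b ^ 2 / a + max 1 K) * m / c,
    √((b ^ 2 / a + max 1 K) * m ^ 2 / (c * a))]).bddAbove
  simp only [mem_upperBounds, List.mem_cons, List.not_mem_nil, or_false, forall_eq_or_imp,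
    forall_eq, Set.mem_ofPred_eq] at hM
  obtain ⟨hM1, hMb, hMK, hMd, hMmul, hMsol⟩ := hM
  exact ⟨M,
    { a_pos := ha
      one_le := hM1
      coercive := fun k d => (hB k d).1
      norm_matVec := fun k d => (hmatVec k d).trans (by gcongr)
      norm_x := fun k => (hx k).trans hMK
      norm_g0 := fun k => (hg0 k).trans hMK
      norm_g := fun k j => (hg k j).trans hMK
      norm_d0 := fun k => ((R.step1_multiplier k).norm_le ha (hB k _).1).trans
        ((div_le_div_of_nonneg_right (hg0 k) ha.le).trans hMd)
      phi_le := fun k => (hphi k).trans hMK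
      abs_fbar_le := fun k j => (hfbar k j).trans hMK
      abs_obj_le := fun k => (hobj k).trans hMK
      norm_solution_le := fun k _ _ _ _ h hs hr => ((hnd k).norm_solution_le h hs hr).trans
        (by gcongr)
      abs_multiplier_le := fun k _ _ _ _ h hs hr j => (abs_apply_le_norm_toLp _ j).trans
        (((hnd k).norm_multiplier_le h hs hr).trans (by gcongr)) }⟩

end BoundedRun

end NLProblem

section Decrease

theorem tendsto_zero_of_decrease {v w : ℕ → ℝ} {c : ℝ} (hc : 0 < c) (hw : ∀ k, 0 ≤ w k)
    (hv : BddBelow (Set.range v)) (hdec : ∀ k, v (k + 1) ≤ v k - c * w k) :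
    Tendsto w atTop (𝓝 0) := by
  have hanti : Antitone v := antitone_nat_of_succ_le fun k =>
    (hdec k).trans (sub_le_self _ (mul_nonneg hc.le (hw k)))
  have hlim := tendsto_atTop_ciInf hanti hv
  have hdiff : Tendsto (fun k => c⁻¹ * (v k - v (k + 1))) atTop (𝓝 0) := by
    simpa using (hlim.sub ((tendsto_add_atTop_iff_nat 1).2 hlim)).const_mul c⁻¹
  refine squeeze_zero hw (fun k => ?_) hdiff
  rw [le_inv_mul_iff₀ hc]
  linarith [hdec k]

theorem rpow_le_rpow_sub_of_le_sub_rpow {p p' s θ σ : ℝ} (hp : 0 < p) (hp' : 0 ≤ p')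
    (hθσ : θ ≤ σ) (hpos : 0 < 1 + θ - σ) (h : p' ≤ p - s * p ^ σ) :
    p' ^ (1 + θ - σ) ≤ p ^ (1 + θ - σ) - (1 + θ - σ) * (s * p ^ θ) := by
  set q := s * p ^ σ / p with hq
  have hpq : p * (1 - q) = p - s * p ^ σ := by rw [hq]; field_simp
  have hq1 : q ≤ 1 := by
    have : 0 ≤ p * (1 - q) := by linarith
    linarith [nonneg_of_mul_nonneg_right this hp]
  have hbernoulli : (1 - q) ^ (1 + θ - σ) ≤ 1 - (1 + θ - σ) * q := by
    simpa [sub_eq_add_neg] using rpow_one_add_le_one_add_mul_self (neg_le_neg hq1) hpos.le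
      (by linarith : 1 + θ - σ ≤ 1)
  have hpow : p ^ (1 + θ - σ) * q = s * p ^ θ := by
    rw [hq, ← mul_div_assoc, mul_left_comm, ← Real.rpow_add hp, mul_div_assoc,
      ← Real.rpow_sub_one hp.ne']
    ring_nf
  calc p' ^ (1 + θ - σ) ≤ (p * (1 - q)) ^ (1 + θ - σ) := by
        rw [hpq]
        exact Real.rpow_le_rpow hp' h hpos.le
    _ = p ^ (1 + θ - σ) * (1 - q) ^ (1 + θ - σ) := Real.mul_rpow hp.le (by linarith)
    _ ≤ p ^ (1 + θ - σ) * (1 - (1 + θ - σ) * q) := by gcongr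
    _ = p ^ (1 + θ - σ) - (1 + θ - σ) * (p ^ (1 + θ - σ) * q) := by ring
    _ = _ := by rw [hpow]

-- The potential `u + K p ^ (1 + θ - σ)` decreases for large `K`, except at the single index at
-- which `p` may jump to zero.
theorem tendsto_mul_add_rpow_of_decrease {u p t e : ℕ → ℝ} {c C θ σ : ℝ} (hc : 0 < c)
    (hC : 0 ≤ C) (hθ : 0 < θ) (hθσ : θ ≤ σ) (hpos : 0 < 1 + θ - σ) (ht : ∀ k, 0 ≤ t k)
    (he : ∀ k, 0 ≤ e k) (hp : ∀ k, 0 ≤ p k) (hu : BddBelow (Set.range u))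
    (hdecu : ∀ k, u (k + 1) ≤ u k - c * t k * e k + C * t k * p k ^ θ)
    (hdecp : ∀ k, p (k + 1) ≤ max 0 (p k - c * t k * p k ^ σ)) :
    Tendsto (fun k => t k * (e k + p k ^ θ)) atTop (𝓝 0) := by
  have hct : ∀ k, 0 ≤ c * t k := fun k => mul_nonneg hc.le (ht k)
  have hanti : Antitone p := antitone_nat_of_succ_le fun k => (hdecp k).trans
    (max_le (hp k) (sub_le_self _ (mul_nonneg (hct k) (Real.rpow_nonneg (hp k) _))))
  obtain ⟨N, hN⟩ : ∃ N, ∀ k, N ≤ k → 0 < p (k + 1) ∨ p k = 0 := by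
    by_cases hzero : ∃ N, p N = 0
    · obtain ⟨N, hN⟩ := hzero
      exact ⟨N, fun k hk => Or.inr (le_antisymm ((hanti hk).trans hN.le) (hp k))⟩
    · push Not at hzero
      exact ⟨0, fun k _ => Or.inl ((hp _).lt_of_ne' (hzero _))⟩
  have hpow : ∀ k, N ≤ k →
      p (k + 1) ^ (1 + θ - σ) ≤ p k ^ (1 + θ - σ) - (1 + θ - σ) * (c * t k * p k ^ θ) := by
    intro k hk
    rcases hN k hk with hnext | hzero
    · exact rpow_le_rpow_sub_of_le_sub_rpow (hnext.trans_le (hanti k.le_succ)) (hp _) hθσ hpos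
        ((le_max_iff.1 (hdecp k)).resolve_left hnext.not_ge)
    · have hnext : p (k + 1) = 0 := le_antisymm ((hanti k.le_succ).trans hzero.le) (hp _)
      simp [hnext, hzero, Real.zero_rpow hpos.ne', Real.zero_rpow hθ.ne']
  set K := (C + c) / (c * (1 + θ - σ)) with hK
  have hK0 : 0 ≤ K := by positivity
  rw [← tendsto_add_atTop_iff_nat N]
  refine tendsto_zero_of_decrease (v := fun k => u (k + N) + K * p (k + N) ^ (1 + θ - σ)) hc
    (fun k => mul_nonneg (ht _) (add_nonneg (he _) (Real.rpow_nonneg (hp _) _))) ?_ fun k => ?_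
  · obtain ⟨M, hM⟩ := hu
    refine ⟨M, Set.forall_mem_range.2 fun k => (hM ⟨k + N, rfl⟩).trans ?_⟩
    exact le_add_of_nonneg_right (mul_nonneg hK0 (Real.rpow_nonneg (hp _) _))
  · have hKp := mul_le_mul_of_nonneg_left (hpow (k + N) (by lia)) hK0
    have hKc : K * ((1 + θ - σ) * (c * t (k + N) * p (k + N) ^ θ)) =
        (C + c) * t (k + N) * p (k + N) ^ θ := by
      rw [hK]
      field_simp
    rw [add_right_comm k 1 N]
    linarith [hdecu (k + N)]

end Decrease

theorem AlgParams.sigma_pos (A : AlgParams) : 0 < A.sigma := A.theta_pos.trans A.theta_lt_sigma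

namespace NLProblem

section SufficientDecrease

variable {n m : ℕ} {P : NLProblem n m} {A : AlgParams} {R : P.Run A} {a M : ℝ} {k : ℕ}
  {x y d0 d1 dt q : EuclideanSpace ℝ (Fin n)} {t : ℝ}

theorem Iteration.trace_or_steps45 {B : Matrix (Fin n) (Fin n) ℝ} {tr : List ℕ}
    (hit : P.Iteration A x B d0 d1 tr t q) :
    (tr = [1, 2, 3, 6] ∧ q = d0 + d1 ∧ P.Step3Succeeds A x d0 (d0 + d1) t) ∨
    (P.Steps45 A x B d0 q t ∧
      (¬ P.Step2Test A x d0 (d0 + d1) ∨ P.Step3Fails A x d0 (d0 + d1))) := by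
  cases hit with
  | cycleI test success => exact Or.inl ⟨rfl, rfl, success⟩
  | step3Failed test failure steps45 => exact Or.inr ⟨steps45, Or.inr failure⟩
  | testFailed test steps45 => exact Or.inr ⟨steps45, Or.inl test⟩

/-- The residual `‖d₀ᵏ‖² + φ(xᵏ)^s` of iteration `k`: with `s = θ` it is what an iteration gains in
the merit potential, with `s = σ` it bounds the higher-order correction. -/
noncomputable def Run.residual (R : P.Run A) (s : ℝ) (k : ℕ) : ℝ := ‖R.d0 k‖ ^ 2 + P.phi (R.x k) ^ s

theorem Run.residual_nonneg (R : P.Run A) (s : ℝ) (k : ℕ) : 0 ≤ R.residual s k :=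
  add_nonneg (sq_nonneg _) (rpow_phi_nonneg _ _)

theorem Run.step_pos_le_one (R : P.Run A) (k : ℕ) : 0 < R.t k ∧ R.t k ≤ 1 := by
  rcases (R.iteration k).trace_or_steps45 with ⟨-, -, i, hi, -⟩ | ⟨⟨_, _, -, -, i, hi, -⟩, -⟩
  · rw [hi]
    exact ⟨by positivity, pow_le_one₀ (by norm_num) (by norm_num)⟩
  · rw [hi]
    exact ⟨pow_pos A.eta_mem.1 _, pow_le_one₀ A.eta_mem.1.le A.eta_mem.2.le⟩

theorem phi_le_max {δ : ℝ} (hv : ∀ j, 0 < P.con j x → P.con j y ≤ P.phi x - δ)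
    (hs : ∀ j, P.con j x ≤ 0 → P.con j y ≤ 0) : P.phi y ≤ max 0 (P.phi x - δ) := by
  refine phi_le_iff.2 ⟨le_max_left _ _, fun j => ?_⟩
  rcases le_or_gt (P.con j x) 0 with hj | hj
  · exact (hs j hj).trans (le_max_left _ _)
  · exact (hv j hj).trans (le_max_right _ _)

theorem beta_mem_Icc (hd : inner ℝ (P.g0 x) d0 ≤ 0) : P.beta A x d0 dt ∈ Set.Icc (0 : ℝ) 1 := by
  unfold beta
  split_ifs with hlt
  · have hθ := A.theta_lt_sigma.trans A.sigma_lt_one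
    refine ⟨le_min zero_le_one (div_nonneg (add_nonneg ?_ (rpow_phi_nonneg x _)) (by linarith)),
      min_le_left _ _⟩
    exact mul_nonneg_of_nonpos_of_nonpos (by linarith) hd
  · exact ⟨zero_le_one, le_rfl⟩

theorem inner_g0_combination_le (hd : inner ℝ (P.g0 x) d0 ≤ 0) :
    inner ℝ (P.g0 x) ((1 - P.beta A x d0 dt) • d0 + P.beta A x d0 dt • dt) ≤
      A.theta * inner ℝ (P.g0 x) d0 + P.phi x ^ A.theta := by
  have hθ := A.theta_lt_sigma.trans A.sigma_lt_one
  have hφ := rpow_phi_nonneg (P := P) x A.theta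
  rw [inner_add_right, inner_smul_right, inner_smul_right]
  unfold beta
  split_ifs with hlt
  · have hbeta := min_le_right 1 (((A.theta - 1) * inner ℝ (P.g0 x) d0 + P.phi x ^ A.theta) /
      (inner ℝ (P.g0 x) dt - inner ℝ (P.g0 x) d0))
    rw [le_div_iff₀ (by linarith)] at hbeta
    linarith
  · linarith [mul_nonneg_of_nonpos_of_nonpos (by linarith : A.theta - 1 ≤ 0) hd]

theorem Step3Conditions.obj_le (hc : P.Step3Conditions A x d0 q t) (ht : 0 ≤ t)
    (hd : inner ℝ (P.g0 x) d0 ≤ -(a * ‖d0‖ ^ 2)) :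
    P.obj (x + t • q) ≤
      P.obj x - A.alpha * a * t * ‖d0‖ ^ 2 + (A.rho + 1) * t * P.phi x ^ A.theta := by
  have hα := A.alpha_mem.1
  have hρ := A.one_lt_rho
  have hdesc : A.alpha * t * inner ℝ (P.g0 x) d0 ≤ A.alpha * t * -(a * ‖d0‖ ^ 2) := by gcongr
  have hφ : A.rho * (1 - A.alpha) * (t * P.phi x ^ A.theta) ≤
      (A.rho + 1) * (t * P.phi x ^ A.theta) :=
    mul_le_mul_of_nonneg_right (by nlinarith) (mul_nonneg ht (rpow_phi_nonneg x _))
  linarith [hc.objective]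

theorem Step3Conditions.phi_le (hc : P.Step3Conditions A x d0 q t) (ht : 0 ≤ t) :
    P.phi (x + t • q) ≤ max 0 (P.phi x - A.alpha * t * P.phi x ^ A.sigma) := by
  refine (phi_le_max hc.violated hc.satisfied).trans (max_le_max le_rfl (sub_le_sub_left ?_ _))
  have hτ : 0 ≤ ‖d0‖ ^ A.tau := Real.rpow_nonneg (norm_nonneg _) _
  exact mul_le_mul_of_nonneg_left (le_add_of_nonneg_left hτ) (mul_nonneg A.alpha_mem.1.le ht)

theorem Step5Conditions.obj_le {β : ℝ} (hc : P.Step5Conditions A x d0 q β t) (ht : 0 ≤ t)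
    (hd : inner ℝ (P.g0 x) d0 ≤ -(a * ‖d0‖ ^ 2))
    (hq : inner ℝ (P.g0 x) q ≤ A.theta * inner ℝ (P.g0 x) d0 + P.phi x ^ A.theta) :
    P.obj (x + t • q) ≤
      P.obj x - A.gamma * A.theta * a * t * ‖d0‖ ^ 2 + (A.rho + 1) * t * P.phi x ^ A.theta := by
  obtain ⟨hγ, hγ1⟩ := A.gamma_mem
  have hθ := A.theta_pos
  have hρ := A.one_lt_rho
  have hdesc : A.gamma * t * inner ℝ (P.g0 x) q ≤
      A.gamma * t * (A.theta * -(a * ‖d0‖ ^ 2) + P.phi x ^ A.theta) := by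
    refine mul_le_mul_of_nonneg_left (hq.trans ?_) (mul_nonneg hγ.le ht)
    gcongr
  have hφ : (A.gamma + A.rho * (1 - A.gamma)) * (t * P.phi x ^ A.theta) ≤
      (A.rho + 1) * (t * P.phi x ^ A.theta) :=
    mul_le_mul_of_nonneg_right (by nlinarith) (mul_nonneg ht (rpow_phi_nonneg x _))
  linarith [hc.objective]

theorem Step5Conditions.phi_le {β : ℝ} (hc : P.Step5Conditions A x d0 q β t) :
    P.phi (x + t • q) ≤
      max 0 (P.phi x - A.gamma * t * (β * (‖d0‖ + P.phi x ^ A.sigma))) := by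
  simpa only [mul_assoc] using phi_le_max hc.violated hc.satisfied

namespace Run.Bounded

theorem pos (h : R.Bounded a M) : 0 < M := zero_lt_one.trans_le h.one_le

theorem inner_g0_le (h : R.Bounded a M) (k : ℕ) :
    inner ℝ (P.g0 (R.x k)) (R.d0 k) ≤ -(a * ‖R.d0 k‖ ^ 2) :=
  (R.step1_multiplier k).inner_g0_le.trans (neg_le_neg (h.coercive k _))

theorem inner_g0_nonpos (h : R.Bounded a M) (k : ℕ) : inner ℝ (P.g0 (R.x k)) (R.d0 k) ≤ 0 :=
  (h.inner_g0_le k).trans (neg_nonpos.2 (mul_nonneg h.a_pos.le (sq_nonneg _)))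

theorem rpow_phi_le (h : R.Bounded a M) (k : ℕ) {s : ℝ} (hs : 0 ≤ s) (hs1 : s ≤ 1) :
    P.phi (R.x k) ^ s ≤ M :=
  calc P.phi (R.x k) ^ s ≤ M ^ s := Real.rpow_le_rpow (phi_nonneg _) (h.phi_le k) hs
    _ ≤ M ^ (1 : ℝ) := Real.rpow_le_rpow_of_exponent_le h.one_le hs1
    _ = M := Real.rpow_one M

theorem rpow_sigma_le (h : R.Bounded a M) (k : ℕ) :
    P.phi (R.x k) ^ A.sigma ≤ M * P.phi (R.x k) ^ A.theta := by
  have hθσ := A.theta_lt_sigma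
  have hσ := A.sigma_lt_one
  have hθ := A.theta_pos
  calc P.phi (R.x k) ^ A.sigma =
        P.phi (R.x k) ^ (A.sigma - A.theta) * P.phi (R.x k) ^ A.theta := by
        rw [← Real.rpow_add_of_nonneg (phi_nonneg _) (by linarith) hθ.le, sub_add_cancel]
    _ ≤ M * P.phi (R.x k) ^ A.theta :=
      mul_le_mul_of_nonneg_right (h.rpow_phi_le k (by linarith) (by linarith))
        (rpow_phi_nonneg _ _)

section Steps45

variable {z : Fin m → ℝ}
  (hsol : P.SolvesSLE (R.x k) (R.B k) (R.d0 k) (P.rhsTilde A (R.x k) (R.d0 k)) dt z)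

include hsol

theorem norm_tilde_le (h : R.Bounded a M) :
    ‖dt‖ ≤ M * (‖R.d0 k‖ + P.phi (R.x k) ^ A.sigma) := by
  have hw : 0 ≤ ‖R.d0 k‖ + P.phi (R.x k) ^ A.sigma :=
    add_nonneg (norm_nonneg _) (rpow_phi_nonneg _ _)
  exact h.norm_solution_le k hsol hw fun j => by rw [rhsTilde, abs_neg, abs_of_nonneg hw]

theorem inner_g0_tilde_sub_le (h : R.Bounded a M) :
    inner ℝ (P.g0 (R.x k)) dt - inner ℝ (P.g0 (R.x k)) (R.d0 k) ≤
      2 * M ^ 2 * (‖R.d0 k‖ + P.phi (R.x k) ^ A.sigma) := by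
  set w := ‖R.d0 k‖ + P.phi (R.x k) ^ A.sigma
  have hM := h.pos
  have hdw : ‖R.d0 k‖ ≤ w := le_add_of_nonneg_right (rpow_phi_nonneg _ _)
  have hw : w ≤ M * w := le_mul_of_one_le_left ((norm_nonneg _).trans hdw) h.one_le
  calc inner ℝ (P.g0 (R.x k)) dt - inner ℝ (P.g0 (R.x k)) (R.d0 k)
      = inner ℝ (P.g0 (R.x k)) (dt - R.d0 k) := (inner_sub_right ..).symm
    _ ≤ ‖P.g0 (R.x k)‖ * ‖dt - R.d0 k‖ := real_inner_le_norm _ _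
    _ ≤ M * (M * w + M * w) := by
      gcongr
      · exact h.norm_g0 k
      · exact (norm_sub_le _ _).trans (add_le_add (h.norm_tilde_le hsol) (hdw.trans hw))
    _ = 2 * M ^ 2 * w := by ring

theorem min_le_beta_mul (h : R.Bounded a M) :
    min (‖R.d0 k‖ + P.phi (R.x k) ^ A.sigma)
      (((1 - A.theta) * a * ‖R.d0 k‖ ^ 2 + P.phi (R.x k) ^ A.theta) / (2 * M ^ 2)) ≤
    P.beta A (R.x k) (R.d0 k) dt * (‖R.d0 k‖ + P.phi (R.x k) ^ A.sigma) := by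
  have hθ := A.theta_lt_sigma.trans A.sigma_lt_one
  have hgap := h.inner_g0_tilde_sub_le hsol
  have hdesc : (1 - A.theta) * (a * ‖R.d0 k‖ ^ 2) ≤
      (1 - A.theta) * -inner ℝ (P.g0 (R.x k)) (R.d0 k) :=
    mul_le_mul_of_nonneg_left (le_neg_of_le_neg (h.inner_g0_le k)) (by linarith)
  have hnum : 0 ≤ (1 - A.theta) * (a * ‖R.d0 k‖ ^ 2) + P.phi (R.x k) ^ A.theta :=
    add_nonneg (mul_nonneg (by linarith) (mul_nonneg h.a_pos.le (sq_nonneg _)))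
      (rpow_phi_nonneg _ _)
  have hw : 0 ≤ ‖R.d0 k‖ + P.phi (R.x k) ^ A.sigma :=
    add_nonneg (norm_nonneg _) (rpow_phi_nonneg _ _)
  unfold beta
  split_ifs with hlt
  · have hgap0 := sub_pos.2 hlt
    rw [min_mul_of_nonneg _ _ hw, one_mul]
    refine min_le_min_left _ ?_
    have hM := h.pos
    rw [div_mul_eq_mul_div, div_le_div_iff₀ (by positivity) hgap0]
    calc _ ≤ ((A.theta - 1) * inner ℝ (P.g0 (R.x k)) (R.d0 k) + P.phi (R.x k) ^ A.theta) *
          (2 * M ^ 2 * (‖R.d0 k‖ + P.phi (R.x k) ^ A.sigma)) :=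
          mul_le_mul (by linarith) hgap hgap0.le (by linarith)
      _ = _ := by ring
  · rw [one_mul]
    exact min_le_left _ _

theorem rpow_sigma_le_beta_mul (h : R.Bounded a M) :
    P.phi (R.x k) ^ A.sigma / (2 * M ^ 3) ≤
    P.beta A (R.x k) (R.d0 k) dt * (‖R.d0 k‖ + P.phi (R.x k) ^ A.sigma) := by
  have hM := h.pos
  have hσ := rpow_phi_nonneg (P := P) (R.x k) A.sigma
  have hθ := A.theta_lt_sigma.trans A.sigma_lt_one
  refine le_trans (le_min ?_ ?_) (h.min_le_beta_mul hsol)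
  · exact (div_le_self hσ (by linarith [one_le_pow₀ h.one_le (n := 3)])).trans
      (le_add_of_nonneg_left (norm_nonneg _))
  · rw [pow_succ' M 2, mul_left_comm, ← div_div]
    refine div_le_div_of_nonneg_right ?_ (by positivity)
    rw [div_le_iff₀' hM]
    refine (h.rpow_sigma_le k).trans (mul_le_mul_of_nonneg_left ?_ hM.le)
    exact le_add_of_nonneg_left
      (mul_nonneg (mul_nonneg (by linarith) h.a_pos.le) (sq_nonneg _))

end Steps45

theorem exists_decrease (h : R.Bounded a M) : ∃ c > 0, ∀ k,
    P.obj (R.x (k + 1)) ≤ P.obj (R.x k) - c * R.t k * ‖R.d0 k‖ ^ 2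
      + (A.rho + 1) * R.t k * P.phi (R.x k) ^ A.theta ∧
    P.phi (R.x (k + 1)) ≤ max 0 (P.phi (R.x k) - c * R.t k * P.phi (R.x k) ^ A.sigma) := by
  have ha := h.a_pos
  have hM := h.pos
  have hα := A.alpha_mem.1
  have hγ := A.gamma_mem.1
  have hθ := A.theta_pos
  obtain ⟨c, hc, hcαa, hcγa, hcα, hcγ⟩ : ∃ c > 0, c ≤ A.alpha * a ∧ c ≤ A.gamma * A.theta * a ∧
      c ≤ A.alpha ∧ c ≤ A.gamma / (2 * M ^ 3) :=
    ⟨min (min (A.alpha * a) (A.gamma * A.theta * a)) (min A.alpha (A.gamma / (2 * M ^ 3))),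
      by positivity, by simp, by simp, by simp, by simp⟩
  refine ⟨c, hc, fun k => ?_⟩
  have ht := (R.step_pos_le_one k).1.le
  have hσ := rpow_phi_nonneg (P := P) (R.x k) A.sigma
  rw [R.step6_update k]
  rcases (R.iteration k).trace_or_steps45 with ⟨-, hq, -, -, -, hcond, -⟩ |
    ⟨⟨dt, y, hsol, hq, -, -, hcond, -⟩, -⟩
  · rw [hq]
    exact ⟨(hcond.obj_le ht (h.inner_g0_le k)).trans (by gcongr),
      (hcond.phi_le ht).trans (by gcongr)⟩
  · refine ⟨(hcond.obj_le ht (h.inner_g0_le k) ?_).trans (by gcongr),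
      hcond.phi_le.trans (max_le_max le_rfl (sub_le_sub_left ?_ _))⟩
    · rw [hq]
      exact inner_g0_combination_le (h.inner_g0_nonpos k)
    · calc c * R.t k * P.phi (R.x k) ^ A.sigma
          ≤ A.gamma / (2 * M ^ 3) * R.t k * P.phi (R.x k) ^ A.sigma := by gcongr
        _ = A.gamma * R.t k * (P.phi (R.x k) ^ A.sigma / (2 * M ^ 3)) := by ring
        _ ≤ _ := mul_le_mul_of_nonneg_left (h.rpow_sigma_le_beta_mul hsol) (by positivity)

theorem tendsto_step_mul (h : R.Bounded a M) :
    Tendsto (fun k => R.t k * R.residual A.theta k) atTop (𝓝 0) := by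
  obtain ⟨c, hc, hdec⟩ := h.exists_decrease
  exact tendsto_mul_add_rpow_of_decrease (u := fun k => P.obj (R.x k))
    (p := fun k => P.phi (R.x k)) hc (by linarith [A.one_lt_rho]) A.theta_pos
    A.theta_lt_sigma.le (by linarith [A.theta_pos, A.sigma_lt_one])
    (fun k => (R.step_pos_le_one k).1.le) (fun k => sq_nonneg _)
    (fun k => phi_nonneg _)
    ⟨-M, Set.forall_mem_range.2 fun k => (abs_le.1 (h.abs_obj_le k)).1⟩
    (fun k => (hdec k).1) fun k => (hdec k).2

end Run.Bounded

end SufficientDecrease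

end NLProblem

section Sequences

theorem frequently_mem_Icc_of_tendsto_sub {u : ℕ → ℝ} {a b : ℝ} (hab : a < b)
    (hinc : Tendsto (fun k => u (k + 1) - u k) atTop (𝓝 0)) (hlow : ∃ᶠ k in atTop, u k < a)
    (hhigh : ∃ᶠ k in atTop, a ≤ u k) : ∃ᶠ k in atTop, u k ∈ Set.Icc a b := by
  intro havoid
  obtain ⟨N, hN⟩ :=
    eventually_atTop.1 (havoid.and (hinc.eventually (gt_mem_nhds (sub_pos.2 hab))))
  obtain ⟨k₁, hk₁, hlow₁⟩ := frequently_atTop.1 hlow N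
  obtain ⟨k₂, hk₂, hhigh₂⟩ := frequently_atTop.1 hhigh k₁
  refine hhigh₂.not_gt ?_
  clear hhigh₂
  induction k₂, hk₂ using Nat.le_induction with
  | base => exact hlow₁
  | succ k hk ih =>
    by_contra hge
    exact (hN (k + 1) (by lia)).1 ⟨not_lt.1 hge, by linarith [(hN k (by lia)).2]⟩

theorem tendsto_of_isolated_mapClusterPt {E : Type*} [NormedAddCommGroup E] [ProperSpace E]
    {x : ℕ → E} {z : E} (hinc : Tendsto (fun k => ‖x (k + 1) - x k‖) atTop (𝓝 0))
    (hz : MapClusterPt z atTop x) (hiso : ∀ᶠ y in 𝓝 z, MapClusterPt y atTop x → y = z) :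
    Tendsto x atTop (𝓝 z) := by
  rw [Metric.tendsto_nhds]
  intro ε hε
  by_contra hfar
  obtain ⟨r, hr, hiso⟩ := Metric.nhds_basis_closedBall.eventually_iff.1 hiso
  set δ := min ε r
  have hδ : 0 < δ := lt_min hε hr
  have hdist : Tendsto (fun k => dist (x (k + 1)) z - dist (x k) z) atTop (𝓝 0) := by
    refine squeeze_zero_norm (fun k => ?_) hinc
    rw [Real.norm_eq_abs, ← dist_eq_norm (x (k + 1))]
    exact abs_dist_sub_le _ _ _
  have hannulus : ∃ᶠ k in atTop, x k ∈ {y | dist y z ∈ Set.Icc (δ / 2) δ} :=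
    frequently_mem_Icc_of_tendsto_sub (half_lt_self hδ) hdist
      (mapClusterPt_iff_frequently.1 hz _ (Metric.ball_mem_nhds z (half_pos hδ)))
      ((not_eventually.1 hfar).mono fun k hk =>
        (half_le_self hδ.le).trans ((min_le_left _ _).trans (not_lt.1 hk)))
  have hclosed : IsClosed {y | dist y z ∈ Set.Icc (δ / 2) δ} :=
    isClosed_Icc.preimage (continuous_id.dist continuous_const)
  have hcompact : IsCompact {y | dist y z ∈ Set.Icc (δ / 2) δ} :=
    (isCompact_closedBall z δ).of_isClosed_subset hclosed fun y hy => hy.2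
  obtain ⟨y, ⟨hlow, hhigh⟩, hy⟩ := hcompact.exists_mapClusterPt_of_frequently hannulus
  rw [hiso (hhigh.trans (min_le_right _ _)) hy, dist_self] at hlow
  exact hlow.not_gt (half_pos hδ)

end Sequences

theorem norm_convex_combination_le {E : Type*} [SeminormedAddCommGroup E] [NormedSpace ℝ E]
    {β : ℝ} (hβ : β ∈ Set.Icc (0 : ℝ) 1) (u v : E) :
    ‖(1 - β) • u + β • v‖ ≤ ‖u‖ + ‖v‖ := by
  refine norm_add_le_of_le ?_ ?_
  · rw [norm_smul, Real.norm_of_nonneg (sub_nonneg.2 hβ.2)]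
    exact mul_le_of_le_one_left (norm_nonneg _) (sub_le_self _ hβ.1)
  · rw [norm_smul, Real.norm_of_nonneg hβ.1]
    exact mul_le_of_le_one_left (norm_nonneg _) hβ.2

namespace NLProblem

section Steplengths

variable {n m : ℕ} {P : NLProblem n m} {A : AlgParams} {R : P.Run A} {a M : ℝ} {k : ℕ}
  {x d0 dt q : EuclideanSpace ℝ (Fin n)} {z : Fin m → ℝ} {t : ℝ}

theorem con_sub_fbar_of_pos {j : Fin m} (hj : 0 < P.con j x) :
    P.con j x - P.fbar j x = P.phi x := by
  rw [fbar, if_neg hj.not_ge, sub_sub_cancel]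

theorem con_sub_fbar_of_nonpos {j : Fin m} (hj : P.con j x ≤ 0) :
    P.con j x - P.fbar j x = 0 := by
  rw [fbar, if_pos hj, sub_self]

theorem Step5Conditions.of_linearization {β K H : ℝ} (ht : 0 ≤ t) (hβ : 0 ≤ β)
    (hobj : P.obj (x + t • q) ≤ P.obj x + t * inner ℝ (P.g0 x) q + t * (t * K))
    (hcon : ∀ j, P.con j (x + t • q) ≤ P.con j x + t * inner ℝ (P.g j x) q + t * (t * K))
    (hg : ∀ j, inner ℝ (P.g j x) q ≤ -P.fbar j x * H - β * (‖d0‖ + P.phi x ^ A.sigma))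
    (htH : t * H ≤ 1)
    (hKobj : t * K ≤ (1 - A.gamma) * (A.rho * P.phi x ^ A.theta - inner ℝ (P.g0 x) q))
    (hKcon : t * K ≤ (1 - A.gamma) * (β * (‖d0‖ + P.phi x ^ A.sigma))) :
    P.Step5Conditions A x d0 q β t := by
  have hσ := rpow_phi_nonneg (P := P) x A.sigma
  have hγ := A.gamma_mem.1
  have hdec : 0 ≤ A.gamma * t * β * (‖d0‖ + P.phi x ^ A.sigma) := by positivity
  have hmain : ∀ j, P.con j (x + t • q) ≤ P.con j x - P.fbar j x
      - A.gamma * t * β * (‖d0‖ + P.phi x ^ A.sigma) := fun j => by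
    have hlin := mul_le_mul_of_nonneg_left (hg j) ht
    have hfbar := mul_le_mul_of_nonneg_left htH (neg_nonneg.2 (fbar_nonpos (P := P) j x))
    linarith [hcon j, mul_le_mul_of_nonneg_left hKcon ht]
  refine ⟨?_, fun j hj => ?_, fun j hj => ?_⟩
  · linarith [mul_le_mul_of_nonneg_left hKobj ht]
  · linarith [hmain j, con_sub_fbar_of_pos hj]
  · linarith [hmain j, con_sub_fbar_of_nonpos hj]

namespace Run.Bounded

section Direction

theorem exists_linearization_bound (h : R.Bounded a M) (hobj : ContDiff ℝ 2 P.obj)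
    (hcon : ∀ j, ContDiff ℝ 2 (P.con j)) {Q : ℝ} (hQ : 0 ≤ Q) :
    ∃ K, ∀ k q t, ‖q‖ ≤ Q → t ∈ Set.Icc (0 : ℝ) 1 →
      P.obj (R.x k + t • q) ≤
        P.obj (R.x k) + t * inner ℝ (P.g0 (R.x k)) q + t * (t * K) ∧
      ∀ j, P.con j (R.x k + t • q) ≤
        P.con j (R.x k) + t * inner ℝ (P.g j (R.x k)) q + t * (t * K) := by
  obtain ⟨C, hC, htaylor⟩ := exists_taylor_bound_closedBall hobj hcon (M + Q)
  refine ⟨C * Q ^ 2, fun k q t hq ht => ?_⟩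
  have htq : ‖t • q‖ ≤ t * Q := by
    rw [norm_smul, Real.norm_of_nonneg ht.1]
    exact mul_le_mul_of_nonneg_left hq ht.1
  have hrem : C * ‖t • q‖ ^ 2 ≤ t * (t * (C * Q ^ 2)) :=
    calc C * ‖t • q‖ ^ 2 ≤ C * (t * Q) ^ 2 := by gcongr
      _ = _ := by ring
  obtain ⟨hobj, hcon⟩ := htaylor (R.x k) (t • q) ((h.norm_x k).trans (le_add_of_nonneg_right hQ))
    (norm_add_le_of_le (h.norm_x k) (htq.trans (mul_le_of_le_one_left hQ ht.2)))
  simp only [inner_smul_right] at hobj hcon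
  exact ⟨by linarith [(abs_le.1 hobj).2], fun j => by linarith [(abs_le.1 (hcon j).2).2]⟩

theorem diagD_le (h : R.Bounded a M) (k : ℕ) (j : Fin m) :
    P.diagD (R.x k) (R.d0 k) j ≤ -P.fbar j (R.x k) * (3 * M ^ 2) := by
  have hM := h.pos
  have hsum : |P.fbar j (R.x k) + inner ℝ (P.g j (R.x k)) (R.d0 k)| ≤ M + M * M :=
    (abs_add_le _ _).trans (add_le_add (h.abs_fbar_le k j)
      ((abs_real_inner_le_norm _ _).trans
        (mul_le_mul (h.norm_g k j) (h.norm_d0 k) (norm_nonneg _) hM.le)))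
  rw [diagD, abs_of_nonpos (fbar_nonpos j _)]
  refine mul_le_mul_of_nonneg_left ?_ (neg_nonneg.2 (fbar_nonpos j _))
  nlinarith [h.norm_d0 k, h.one_le]

theorem norm_d0_add_rpow_sigma_le (h : R.Bounded a M) (k : ℕ) :
    ‖R.d0 k‖ + P.phi (R.x k) ^ A.sigma ≤ 2 * M := by
  linarith [h.norm_d0 k, h.rpow_phi_le k A.sigma_pos.le A.sigma_lt_one.le]

theorem min_mul_le_sub_inner_g0 (h : R.Bounded a M) (k : ℕ) (dt : EuclideanSpace ℝ (Fin n)) :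
    min (A.rho - 1) (A.theta * a) * R.residual A.theta k ≤
      A.rho * P.phi (R.x k) ^ A.theta - inner ℝ (P.g0 (R.x k))
        ((1 - P.beta A (R.x k) (R.d0 k) dt) • R.d0 k + P.beta A (R.x k) (R.d0 k) dt • dt) := by
  have hθ := mul_le_mul_of_nonneg_right (min_le_left (A.rho - 1) (A.theta * a))
    (rpow_phi_nonneg (P := P) (R.x k) A.theta)
  have hd := mul_le_mul_of_nonneg_right (min_le_right (A.rho - 1) (A.theta * a))
    (sq_nonneg ‖R.d0 k‖)
  rw [Run.residual]
  linarith [mul_le_mul_of_nonneg_left (h.inner_g0_le k) A.theta_pos.le,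
    inner_g0_combination_le (A := A) (dt := dt) (h.inner_g0_nonpos k)]

theorem inner_g_combination_le (h : R.Bounded a M)
    (hsol : P.SolvesSLE (R.x k) (R.B k) (R.d0 k) (P.rhsTilde A (R.x k) (R.d0 k)) dt z) (j : Fin m) :
    inner ℝ (P.g j (R.x k))
        ((1 - P.beta A (R.x k) (R.d0 k) dt) • R.d0 k + P.beta A (R.x k) (R.d0 k) dt • dt) ≤
      -P.fbar j (R.x k) * (1 + 6 * M ^ 4) -
        P.beta A (R.x k) (R.d0 k) dt * (‖R.d0 k‖ + P.phi (R.x k) ^ A.sigma) := by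
  obtain ⟨hβ0, hβ1⟩ := beta_mem_Icc (A := A) (dt := dt) (h.inner_g0_nonpos k)
  set β := P.beta A (R.x k) (R.d0 k) dt
  set w := ‖R.d0 k‖ + P.phi (R.x k) ^ A.sigma
  have hM := h.pos
  have hw0 : 0 ≤ w := add_nonneg (norm_nonneg _) (rpow_phi_nonneg _ _)
  have hfbar := neg_nonneg.2 (fbar_nonpos (P := P) j (R.x k))
  have hz : |z j| ≤ M * (2 * M) := (h.abs_multiplier_le k hsol hw0
    (fun j => by rw [rhsTilde, abs_neg, abs_of_nonneg hw0]) j).trans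
      (mul_le_mul_of_nonneg_left (h.norm_d0_add_rpow_sigma_le k) hM.le)
  have hDz : P.diagD (R.x k) (R.d0 k) j * z j ≤ -P.fbar j (R.x k) * (6 * M ^ 4) :=
    calc P.diagD (R.x k) (R.d0 k) j * z j ≤ P.diagD (R.x k) (R.d0 k) j * |z j| :=
          mul_le_mul_of_nonneg_left (le_abs_self _) (diagD_nonneg _ _ _)
      _ ≤ -P.fbar j (R.x k) * (3 * M ^ 2) * (M * (2 * M)) :=
          mul_le_mul (h.diagD_le k j) hz (abs_nonneg _) (by positivity)
      _ = _ := by ring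
  have hdt : inner ℝ (P.g j (R.x k)) dt ≤ -w + -P.fbar j (R.x k) * (6 * M ^ 4) := by
    have hlin := hsol.linearized j
    rw [rhsTilde] at hlin
    linarith
  have hd0 : inner ℝ (P.g j (R.x k)) (R.d0 k) ≤ -P.fbar j (R.x k) := by
    linarith [(R.step1_solution k).1 j]
  rw [inner_add_right, inner_smul_right, inner_smul_right]
  calc _ ≤ (1 - β) * -P.fbar j (R.x k) + β * (-w + -P.fbar j (R.x k) * (6 * M ^ 4)) :=
        add_le_add (mul_le_mul_of_nonneg_left hd0 (sub_nonneg.2 hβ1))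
          (mul_le_mul_of_nonneg_left hdt hβ0)
    _ = (1 - β) * -P.fbar j (R.x k) + β * (-P.fbar j (R.x k) * (6 * M ^ 4)) - β * w := by ring
    _ ≤ 1 * -P.fbar j (R.x k) + 1 * (-P.fbar j (R.x k) * (6 * M ^ 4)) - β * w := by
      gcongr
      linarith
    _ = _ := by ring

theorem exists_pos_le_beta_mul (h : R.Bounded a M) {ν : ℝ} (hν : 0 < ν) :
    ∃ ω > 0, ∀ k, ν ≤ R.residual A.theta k →
      ∀ dt z, P.SolvesSLE (R.x k) (R.B k) (R.d0 k) (P.rhsTilde A (R.x k) (R.d0 k)) dt z →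
        ω ≤ P.beta A (R.x k) (R.d0 k) dt * (‖R.d0 k‖ + P.phi (R.x k) ^ A.sigma) := by
  have hM := h.pos
  have hθ := A.theta_pos
  have hσ := A.sigma_pos
  set κ := min ((1 - A.theta) * a) 1
  have hκ0 : 0 < κ :=
    lt_min (mul_pos (sub_pos.2 (A.theta_lt_sigma.trans A.sigma_lt_one)) h.a_pos) one_pos
  refine ⟨min (min (ν / (2 * M)) ((ν / 2) ^ (A.sigma / A.theta))) (κ * ν / (2 * M ^ 2)),
    by positivity, fun k hk dt z hsol => le_trans (min_le_min ?_ ?_) (h.min_le_beta_mul hsol)⟩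
  · rcases le_total (ν / 2) (P.phi (R.x k) ^ A.theta) with hφ | hφ
    · calc _ ≤ (ν / 2) ^ (A.sigma / A.theta) := min_le_right _ _
        _ ≤ (P.phi (R.x k) ^ A.theta) ^ (A.sigma / A.theta) := by gcongr
        _ = P.phi (R.x k) ^ A.sigma := by
          rw [← Real.rpow_mul (phi_nonneg _), mul_div_cancel₀ _ hθ.ne']
        _ ≤ _ := le_add_of_nonneg_left (norm_nonneg _)
    · refine (min_le_left _ _).trans
        (le_trans ?_ (le_add_of_nonneg_right (rpow_phi_nonneg _ _)))
      rw [Run.residual] at hk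
      rw [div_le_iff₀ (by positivity)]
      nlinarith [norm_nonneg (R.d0 k), h.norm_d0 k]
  · gcongr
    calc κ * ν ≤ κ * R.residual A.theta k := by gcongr
      _ = κ * ‖R.d0 k‖ ^ 2 + κ * P.phi (R.x k) ^ A.theta := mul_add _ _ _
      _ ≤ (1 - A.theta) * a * ‖R.d0 k‖ ^ 2 + P.phi (R.x k) ^ A.theta :=
        add_le_add (mul_le_mul_of_nonneg_right (min_le_left _ _) (sq_nonneg _))
          (mul_le_of_le_one_left (rpow_phi_nonneg _ _) (min_le_right _ _))

theorem rpow_tau_le (h : R.Bounded a M) (k : ℕ) : ‖R.d0 k‖ ^ A.tau ≤ M * ‖R.d0 k‖ ^ 2 := by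
  obtain ⟨hτ2, hτ3⟩ := A.tau_mem
  calc ‖R.d0 k‖ ^ A.tau = ‖R.d0 k‖ ^ (A.tau - 2) * ‖R.d0 k‖ ^ (2 : ℝ) := by
        rw [← Real.rpow_add_of_nonneg (norm_nonneg _) (by linarith) (by simp), sub_add_cancel]
    _ ≤ M ^ (A.tau - 2) * ‖R.d0 k‖ ^ (2 : ℝ) := by
      have hd0 := h.norm_d0 k
      gcongr
    _ ≤ M ^ (1 : ℝ) * ‖R.d0 k‖ ^ (2 : ℝ) := by
      have hM := h.one_le
      gcongr
      linarith
    _ = M * ‖R.d0 k‖ ^ 2 := by rw [Real.rpow_one, Real.rpow_two]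

end Direction

section Vanishing

variable (hobj : ContDiff ℝ 2 P.obj) (hcon : ∀ j, ContDiff ℝ 2 (P.con j))

include hobj hcon

theorem eventually_step5Conditions (h : R.Bounded a M) {ν : ℝ} (hν : 0 < ν) :
    ∀ᶠ t in 𝓝[>] (0 : ℝ), ∀ k, ν ≤ R.residual A.theta k →
      ∀ dt z, P.SolvesSLE (R.x k) (R.B k) (R.d0 k) (P.rhsTilde A (R.x k) (R.d0 k)) dt z →
        P.Step5Conditions A (R.x k) (R.d0 k)
          ((1 - P.beta A (R.x k) (R.d0 k) dt) • R.d0 k + P.beta A (R.x k) (R.d0 k) dt • dt)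
          (P.beta A (R.x k) (R.d0 k) dt) t := by
  have hM := h.pos
  obtain ⟨K, hK⟩ := h.exists_linearization_bound hobj hcon (Q := M + M * (2 * M)) (by positivity)
  obtain ⟨ω, hω, hωβ⟩ := h.exists_pos_le_beta_mul hν
  set κ := min (A.rho - 1) (A.theta * a)
  have hκ : 0 < κ := lt_min (sub_pos.2 A.one_lt_rho) (mul_pos A.theta_pos h.a_pos)
  have hγ : 0 < 1 - A.gamma := sub_pos.2 A.gamma_mem.2
  have hsmall : ∀ c {ε : ℝ}, 0 < ε → ∀ᶠ t in 𝓝[>] (0 : ℝ), t * c ≤ ε := fun c ε hε =>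
    ((continuous_mul_const c).tendsto' 0 0 (zero_mul c)).mono_left nhdsWithin_le_nhds
      |>.eventually (ge_mem_nhds hε)
  filter_upwards [self_mem_nhdsWithin, hsmall 1 one_pos, hsmall (1 + 6 * M ^ 4) one_pos,
    hsmall K (mul_pos hγ (mul_pos hκ hν)), hsmall K (mul_pos hγ hω)]
    with t ht ht1 htH htobj htcon k hk dt z hsol
  rw [mul_one] at ht1
  have hβ := beta_mem_Icc (A := A) (dt := dt) (h.inner_g0_nonpos k)
  obtain ⟨hobj, hcon⟩ := hK k _ t ((norm_convex_combination_le hβ (R.d0 k) dt).trans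
    (add_le_add (h.norm_d0 k) ((h.norm_tilde_le hsol).trans
      (mul_le_mul_of_nonneg_left (h.norm_d0_add_rpow_sigma_le k) hM.le)))) ⟨ht.le, ht1⟩
  refine .of_linearization ht.le hβ.1 hobj hcon (h.inner_g_combination_le hsol) htH
    (htobj.trans (mul_le_mul_of_nonneg_left ?_ hγ.le))
    (htcon.trans (mul_le_mul_of_nonneg_left (hωβ k hk dt z hsol) hγ.le))
  exact (mul_le_mul_of_nonneg_left hk hκ.le).trans (h.min_mul_le_sub_inner_g0 k dt)

theorem exists_step_lower_bound (h : R.Bounded a M) {ν : ℝ} (hν : 0 < ν) :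
    ∃ T > 0, ∀ k, ν ≤ R.residual A.theta k → T ≤ R.t k := by
  obtain ⟨T, hT, hstep5⟩ :=
    mem_nhdsGT_iff_exists_Ioc_subset.1 (h.eventually_step5Conditions hobj hcon hν)
  have hη := A.eta_mem.1
  refine ⟨min A.eps (min 1 (A.eta * T)),
    lt_min A.eps_mem.1 (lt_min one_pos (mul_pos hη hT)), fun k hk => ?_⟩
  rcases (R.iteration k).trace_or_steps45 with ⟨-, -, i, -, hε, -⟩ |
    ⟨⟨dt, z, hsol, hq, i, hi, -, hfail⟩, -⟩
  · exact (min_le_left _ _).trans hε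
  · refine (min_le_right _ _).trans ?_
    rcases i with _ | i
    · rw [hi, pow_zero]
      exact min_le_left _ _
    · refine (min_le_right _ _).trans ?_
      rw [hi, pow_succ']
      refine mul_le_mul_of_nonneg_left ?_ hη.le
      by_contra hlt
      rw [hq] at hfail
      exact hfail i i.lt_succ_self
        (hstep5 ⟨pow_pos hη i, (not_le.1 hlt).le⟩ k hk dt z hsol)

theorem tendsto_residual_theta (h : R.Bounded a M) :
    Tendsto (R.residual A.theta) atTop (𝓝 0) := by
  rw [Metric.tendsto_nhds]
  intro ν hν
  obtain ⟨T, hT, hstep⟩ := h.exists_step_lower_bound hobj hcon hν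
  filter_upwards [h.tendsto_step_mul.eventually (gt_mem_nhds (mul_pos hT hν))] with k hk
  rw [Real.dist_0_eq_abs, abs_of_nonneg (R.residual_nonneg _ k)]
  by_contra! hge
  exact hk.not_ge (mul_le_mul (hstep k hge) hge hν.le (R.step_pos_le_one k).1.le)

theorem tendsto_norm_d0 (h : R.Bounded a M) : Tendsto (fun k => ‖R.d0 k‖) atTop (𝓝 0) := by
  have hsq : Tendsto (fun k => ‖R.d0 k‖ ^ 2) atTop (𝓝 0) :=
    squeeze_zero (fun _ => sq_nonneg _) (fun _ => le_add_of_nonneg_right (rpow_phi_nonneg _ _))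
      (h.tendsto_residual_theta hobj hcon)
  simpa [Real.sqrt_sq (norm_nonneg _)] using hsq.sqrt

theorem tendsto_phi (h : R.Bounded a M) : Tendsto (fun k => P.phi (R.x k)) atTop (𝓝 0) := by
  have hθ := A.theta_pos
  have hpow : Tendsto (fun k => P.phi (R.x k) ^ A.theta) atTop (𝓝 0) :=
    squeeze_zero (fun _ => rpow_phi_nonneg _ _) (fun _ => le_add_of_nonneg_left (sq_nonneg _))
      (h.tendsto_residual_theta hobj hcon)
  have hroot := hpow.rpow_const (p := A.theta⁻¹) (Or.inr (by positivity))
  rw [Real.zero_rpow (by positivity)] at hroot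
  exact hroot.congr fun k => Real.rpow_rpow_inv (phi_nonneg _) hθ.ne'

theorem tendsto_rpow_phi (h : R.Bounded a M) {s : ℝ} (hs : 0 < s) :
    Tendsto (fun k => P.phi (R.x k) ^ s) atTop (𝓝 0) := by
  simpa [Real.zero_rpow hs.ne'] using
    (h.tendsto_phi hobj hcon).rpow_const (p := s) (Or.inr hs.le)

theorem exists_rhsCorrection_bound (h : R.Bounded a M) :
    ∃ C > 0, ∀ k j, |P.rhsCorrection A (R.x k) (R.d0 k) j| ≤
      C * R.residual A.sigma k := by
  have hM := h.pos
  obtain ⟨C, hC, htaylor⟩ := exists_taylor_bound_closedBall hobj hcon (M + M)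
  refine ⟨M + 1 + C, by positivity, fun k j => ?_⟩
  have hσ := rpow_phi_nonneg (P := P) (R.x k) A.sigma
  have hτ : 0 ≤ ‖R.d0 k‖ ^ A.tau := Real.rpow_nonneg (norm_nonneg _) _
  have hrem := ((htaylor (R.x k) (R.d0 k) ((h.norm_x k).trans (le_add_of_nonneg_left hM.le))
    (norm_add_le_of_le (h.norm_x k) (h.norm_d0 k))).2 j).2
  calc |P.rhsCorrection A (R.x k) (R.d0 k) j|
      ≤ (‖R.d0 k‖ ^ A.tau + P.phi (R.x k) ^ A.sigma) + C * ‖R.d0 k‖ ^ 2 := by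
        refine (abs_sub _ _).trans (add_le_add ?_ hrem)
        rw [abs_neg, abs_of_nonneg (add_nonneg hτ hσ)]
    _ ≤ (M * ‖R.d0 k‖ ^ 2 + P.phi (R.x k) ^ A.sigma) + C * ‖R.d0 k‖ ^ 2 := by
      gcongr
      exact h.rpow_tau_le k
    _ ≤ _ := by
      rw [Run.residual]
      linarith [mul_nonneg (add_nonneg hM.le hC) hσ, sq_nonneg ‖R.d0 k‖]

theorem exists_correction_bound (h : R.Bounded a M) :
    ∃ C > 0, ∀ k, ‖R.d1 k‖ ≤ C * R.residual A.sigma k ∧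
      ∀ j, |R.h1 k j| ≤ C * R.residual A.sigma k := by
  obtain ⟨C, hC, hr⟩ := h.exists_rhsCorrection_bound hobj hcon
  refine ⟨M * C, mul_pos h.pos hC, fun k => ?_⟩
  have hs : 0 ≤ C * R.residual A.sigma k :=
    mul_nonneg hC.le (R.residual_nonneg _ k)
  simp only [mul_assoc]
  exact ⟨h.norm_solution_le k (R.step2_correction k) hs (hr k),
    h.abs_multiplier_le k (R.step2_correction k) hs (hr k)⟩

theorem tendsto_residual (h : R.Bounded a M) {s : ℝ} (hs : 0 < s) :
    Tendsto (R.residual s) atTop (𝓝 0) := by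
  have hsum := ((h.tendsto_norm_d0 hobj hcon).pow 2).add (h.tendsto_rpow_phi hobj hcon hs)
  rwa [zero_pow two_ne_zero, zero_add] at hsum

theorem tendsto_norm_d1 (h : R.Bounded a M) : Tendsto (fun k => ‖R.d1 k‖) atTop (𝓝 0) := by
  obtain ⟨C, -, hC⟩ := h.exists_correction_bound hobj hcon
  refine squeeze_zero (fun _ => norm_nonneg _) (fun k => (hC k).1) ?_
  simpa using
    (h.tendsto_residual hobj hcon A.sigma_pos).const_mul C

theorem tendsto_increment (h : R.Bounded a M) :
    Tendsto (fun k => ‖R.x (k + 1) - R.x k‖) atTop (𝓝 0) := by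
  have hM := h.pos
  have hd0 := h.tendsto_norm_d0 hobj hcon
  have hlim : Tendsto (fun k => ‖R.d0 k‖ + ‖R.d1 k‖ +
      M * (‖R.d0 k‖ + P.phi (R.x k) ^ A.sigma)) atTop (𝓝 0) := by
    simpa using (hd0.add (h.tendsto_norm_d1 hobj hcon)).add
      ((hd0.add (h.tendsto_rpow_phi hobj hcon A.sigma_pos)).const_mul M)
  refine squeeze_zero (fun _ => norm_nonneg _) (fun k => ?_) hlim
  obtain ⟨ht, ht1⟩ := R.step_pos_le_one k
  have hσ := rpow_phi_nonneg (P := P) (R.x k) A.sigma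
  rw [R.step6_update k, add_sub_cancel_left, norm_smul, Real.norm_of_nonneg ht.le]
  refine (mul_le_of_le_one_left (norm_nonneg _) ht1).trans ?_
  rcases (R.iteration k).trace_or_steps45 with ⟨-, hq, -⟩ | ⟨⟨dt, z, hsol, hq, -⟩, -⟩
  · rw [hq]
    exact (norm_add_le _ _).trans (le_add_of_nonneg_right (by positivity))
  · have hcomb := norm_convex_combination_le
      (beta_mem_Icc (A := A) (dt := dt) (h.inner_g0_nonpos k)) (R.d0 k) dt
    rw [hq]
    linarith [h.norm_tilde_le hsol, norm_nonneg (R.d1 k)]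

end Vanishing

end Run.Bounded

end Steplengths

end NLProblem

section Isolation

variable {E : Type*} [NormedAddCommGroup E] [InnerProductSpace ℝ E] [ProperSpace E]

theorem isBigO_sub_sub_inner_gradient {f : E → ℝ} (hf : ContDiff ℝ 2 f) (z : E) :
    (fun y => f y - f z - inner ℝ (gradient f y) (y - z)) =O[𝓝 z] fun y => ‖y - z‖ ^ 2 := by
  obtain ⟨C, -, hC⟩ := exists_taylor_bound_of_isCompact hf (isCompact_closedBall z 1)
    (convex_closedBall z 1)
  refine .of_bound C ?_
  filter_upwards [Metric.closedBall_mem_nhds z one_pos] with y hy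
  have htaylor := (hC y (z - y) hy (by simp)).2
  rw [add_sub_cancel, ← neg_sub y z, inner_neg_right, norm_neg, sub_neg_eq_add] at htaylor
  rw [norm_pow, norm_norm, Real.norm_eq_abs, ← abs_neg]
  convert htaylor using 2
  ring

theorem isLittleO_inner {E ι : Type*} [NormedAddCommGroup E] [InnerProductSpace ℝ E]
    {l : Filter ι} {v w : ι → E} {f g : ι → ℝ} (hv : v =O[l] f) (hw : w =o[l] g) :
    (fun i => inner ℝ (v i) (w i)) =o[l] fun i => f i * g i :=
  (Asymptotics.isBigO_of_le l fun i =>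
    (norm_inner_le_norm (v i) (w i)).trans (le_abs_self _)).trans_isLittleO
    (hv.norm_left.mul_isLittleO hw.norm_left)

-- If `w i ≠ 0` frequently, a cluster direction `u` of `w` has `⟪u, T u⟫ ≤ 0` and `v j ⊥ u`.
theorem eventually_eq_zero_of_inner_le {ι κ : Type*} {l : Filter ι} {T : E →L[ℝ] E} {J : Set κ}
    {v : κ → E} {w : ι → E} {r : ι → ℝ}
    (hpos : ∀ d ≠ 0, (∀ j ∈ J, inner ℝ (v j) d = 0) → 0 < inner ℝ d (T d))
    (hv : ∀ j ∈ J, (fun i => inner ℝ (v j) (w i)) =o[l] w)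
    (hr : r =o[l] fun i => ‖w i‖ ^ 2) (hle : ∀ᶠ i in l, inner ℝ (w i) (T (w i)) ≤ r i) :
    ∀ᶠ i in l, w i = 0 := by
  by_contra hne
  have : (l ⊓ 𝓟 {i | w i ≠ 0}).NeBot :=
    frequently_mem_iff_neBot.1 (not_eventually.1 hne)
  set U := Ultrafilter.of (l ⊓ 𝓟 {i | w i ≠ 0})
  have hUl : (U : Filter ι) ≤ l := (Ultrafilter.of_le _).trans inf_le_left
  have hU : ∀ᶠ i in (U : Filter ι), w i ≠ 0 :=
    Ultrafilter.of_le _ (mem_inf_of_right (mem_principal_self _))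
  have hsphere : ∀ᶠ i in (U : Filter ι), ‖w i‖⁻¹ • w i ∈ Metric.sphere (0 : E) 1 := by
    filter_upwards [hU] with i hi
    simp [norm_smul, hi]
  obtain ⟨u, hu, hlim : Tendsto (fun i => ‖w i‖⁻¹ • w i) U (𝓝 u)⟩ :=
    (isCompact_sphere (0 : E) 1).ultrafilter_le_nhds (U.map _) (le_principal_iff.2 hsphere)
  have horth : ∀ j ∈ J, inner ℝ (v j) u = 0 := fun j hj => by
    refine tendsto_nhds_unique (tendsto_const_nhds.inner hlim) ?_
    refine ((hv j hj).mono hUl).norm_right.tendsto_div_nhds_zero.congr fun i => ?_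
    rw [inner_smul_right, div_eq_inv_mul]
  refine (hpos u (ne_zero_of_mem_unit_sphere ⟨u, hu⟩) horth).not_ge ?_
  refine le_of_tendsto_of_tendsto (hlim.inner ((T.continuous.tendsto u).comp hlim))
    (hr.mono hUl).tendsto_div_nhds_zero ?_
  filter_upwards [hUl hle, hU] with i hi hwi
  simp only [Function.comp_apply, map_smul, inner_smul_left, inner_smul_right, conj_trivial]
  calc ‖w i‖⁻¹ * (‖w i‖⁻¹ * inner ℝ (w i) (T (w i))) = inner ℝ (w i) (T (w i)) / ‖w i‖ ^ 2 := by
        field_simp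
    _ ≤ r i / ‖w i‖ ^ 2 := by gcongr

end Isolation

namespace NLProblem

section KKTPairs

variable {n m : ℕ} {P : NLProblem n m} {z : EuclideanSpace ℝ (Fin n)} {lam : Fin m → ℝ}
  {ι : Type*} {l : Filter ι} {x : ι → EuclideanSpace ℝ (Fin n)}

theorem tendsto_fbar (hf : ∀ j, Continuous (P.con j)) (hx : Tendsto x l (𝓝 z))
    (hφ : Tendsto (fun i => P.phi (x i)) l (𝓝 0)) (j : Fin m) :
    Tendsto (fun i => P.fbar j (x i)) l (𝓝 (P.con j z)) := by
  have hsub : Tendsto (fun i => P.fbar j (x i) - P.con j (x i)) l (𝓝 0) :=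
    squeeze_zero_norm (fun i => abs_fbar_sub_con_le j (x i)) hφ
  simpa using hsub.add (((hf j).tendsto z).comp hx)

theorem GradientsIndependent.tendsto_zero (hindep : P.GradientsIndependent)
    (hcon : ∀ j, ContDiff ℝ 2 (P.con j)) (hx : Tendsto x l (𝓝 z)) {ν : ι → Fin m → ℝ}
    (hsum : Tendsto (fun i => ∑ j, ν i j • P.g j (x i)) l (𝓝 0))
    (hν : ∀ j, Tendsto (fun i => P.fbar j (x i) * ν i j) l (𝓝 0)) (j : Fin m) :
    Tendsto (fun i => ν i j) l (𝓝 0) := by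
  obtain ⟨c, hc, hgram⟩ := exists_gram_lower_bound (continuous_g hcon)
    (fun j => (hcon j).continuous) hindep (isCompact_closedBall z 1)
  have hlim : Tendsto (fun i => c⁻¹ * (‖∑ j, ν i j • P.g j (x i)‖ ^ 2 +
      ∑ j, (P.fbar j (x i) * ν i j) ^ 2)) l (𝓝 0) := by
    simpa using ((hsum.norm.pow 2).add
      (tendsto_finsetSum Finset.univ fun j _ => (hν j).pow 2)).const_mul c⁻¹
  have hsq : Tendsto (fun i => ν i j ^ 2) l (𝓝 0) := by
    refine squeeze_zero' (Eventually.of_forall fun _ => sq_nonneg _) ?_ hlim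
    filter_upwards [hx.eventually (Metric.closedBall_mem_nhds z one_pos)] with i hi
    rw [le_inv_mul_iff₀ hc]
    refine le_trans ?_ (hgram _ hi (WithLp.toLp 2 (ν i)))
    refine mul_le_mul_of_nonneg_left ?_ hc.le
    exact sq_le_sq' (abs_le.1 (abs_apply_le_norm_toLp (ν i) j)).1
      (abs_le.1 (abs_apply_le_norm_toLp (ν i) j)).2
  rw [tendsto_zero_iff_norm_tendsto_zero]
  simpa [Real.sqrt_sq_eq_abs] using hsq.sqrt

theorem IsKKTPair.phi_eq_zero (h : P.IsKKTPair z lam) : P.phi z = 0 :=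
  le_antisymm (phi_le_iff.2 ⟨le_rfl, h.feasible⟩) (phi_nonneg z)

theorem IsKKTPair.fbar_eq (h : P.IsKKTPair z lam) (j : Fin m) : P.fbar j z = P.con j z :=
  if_pos (h.feasible j)

theorem IsKKTPair.tendsto_multiplier {mu : ι → Fin m → ℝ} (h : P.IsKKTPair z lam)
    (hindep : P.GradientsIndependent) (hobj : ContDiff ℝ 2 P.obj)
    (hcon : ∀ j, ContDiff ℝ 2 (P.con j)) (hx : Tendsto x l (𝓝 z))
    (hφ : Tendsto (fun i => P.phi (x i)) l (𝓝 0))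
    (hstat : Tendsto (fun i => P.g0 (x i) + ∑ j, mu i j • P.g j (x i)) l (𝓝 0))
    (hcomp : ∀ j, Tendsto (fun i => mu i j * P.fbar j (x i)) l (𝓝 0)) (j : Fin m) :
    Tendsto (fun i => mu i j) l (𝓝 (lam j)) := by
  refine tendsto_sub_nhds_zero_iff.1 (hindep.tendsto_zero hcon hx
    (ν := fun i j => mu i j - lam j) ?_ (fun j => ?_) j)
  · have hlam : Tendsto (fun i => P.g0 (x i) + ∑ j, lam j • P.g j (x i)) l (𝓝 0) := by
      rw [← h.stationary]
      exact (((continuous_g0 hobj).tendsto z).comp hx).add (tendsto_finsetSum _ fun j _ =>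
        (((continuous_g hcon j).tendsto z).comp hx).const_smul (lam j))
    simpa [sub_smul] using hstat.sub hlam
  · have hlam := (tendsto_fbar (fun j => (hcon j).continuous) hx hφ j).const_mul (lam j)
    rw [h.complementary j] at hlam
    exact (sub_zero (0 : ℝ) ▸ (hcomp j).sub hlam).congr fun i => by ring

theorem gradient_lagrangian (hobj : ContDiff ℝ 2 P.obj) (hcon : ∀ j, ContDiff ℝ 2 (P.con j))
    (lam : Fin m → ℝ) :
    gradient (P.lagrangian lam) = fun x => P.g0 x + ∑ j, lam j • P.g j x := by
  funext x
  have hgobj : HasGradientAt P.obj (P.g0 x) x :=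
    (hobj.differentiable (by norm_num) x).hasGradientAt
  have hgcon : ∀ j, HasGradientAt (P.con j) (P.g j x) x := fun j =>
    ((hcon j).differentiable (by norm_num) x).hasGradientAt
  refine HasGradientAt.gradient (hasGradientAt_iff_hasFDerivAt.2 ?_)
  refine (hgobj.hasFDerivAt.add
    (HasFDerivAt.fun_sum fun j _ => (hgcon j).hasFDerivAt.const_mul (lam j))).congr_fderiv ?_
  simp [map_add, map_sum]

theorem contDiff_lagrangian (hobj : ContDiff ℝ 2 P.obj) (hcon : ∀ j, ContDiff ℝ 2 (P.con j))
    (lam : Fin m → ℝ) : ContDiff ℝ 2 (P.lagrangian lam) :=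
  hobj.add (ContDiff.sum fun j _ => contDiff_const.mul (hcon j))

theorem IsKKTPair.gradient_lagrangian_eq_zero (h : P.IsKKTPair z lam) (hobj : ContDiff ℝ 2 P.obj)
    (hcon : ∀ j, ContDiff ℝ 2 (P.con j)) : gradient (P.lagrangian lam) z = 0 := by
  rw [gradient_lagrangian hobj hcon]
  exact h.stationary

theorem IsKKTPair.sub_mul_sub_nonneg {y : EuclideanSpace ℝ (Fin n)} {mu : Fin m → ℝ}
    (h : P.IsKKTPair z lam) (h' : P.IsKKTPair y mu) (j : Fin m) :
    0 ≤ (mu j - lam j) * (P.con j y - P.con j z) := by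
  linarith [h.complementary j, h'.complementary j,
    mul_nonneg (h.nonneg j) (neg_nonneg.2 (h'.feasible j)),
    mul_nonneg (h'.nonneg j) (neg_nonneg.2 (h.feasible j))]

theorem IsKKTPair.inner_gradient_lagrangian_le {y : EuclideanSpace ℝ (Fin n)} {mu : Fin m → ℝ}
    (h : P.IsKKTPair z lam) (h' : P.IsKKTPair y mu) (hobj : ContDiff ℝ 2 P.obj)
    (hcon : ∀ j, ContDiff ℝ 2 (P.con j)) :
    inner ℝ (y - z) (gradient (P.lagrangian lam) y) ≤
      ∑ j, (mu j - lam j) * (P.con j y - P.con j z - inner ℝ (P.g j y) (y - z)) := by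
  have hgrad : gradient (P.lagrangian lam) y = -∑ j, (mu j - lam j) • P.g j y := by
    rw [gradient_lagrangian hobj hcon, eq_neg_iff_add_eq_zero, ← h'.stationary]
    simp only [sub_smul, Finset.sum_sub_distrib]
    abel
  rw [hgrad, inner_neg_right, inner_sum, ← Finset.sum_neg_distrib]
  refine Finset.sum_le_sum fun j _ => ?_
  rw [inner_smul_right, real_inner_comm]
  linarith [h.sub_mul_sub_nonneg h' j]

theorem IsKKTPair.isLittleO_inner_g {p : ι → EuclideanSpace ℝ (Fin n) × (Fin m → ℝ)}
    (h : P.IsKKTPair z lam) (hcon : ∀ j, ContDiff ℝ 2 (P.con j))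
    (hp : ∀ᶠ i in l, P.IsKKTPair (p i).1 (p i).2) (hx : Tendsto (fun i => (p i).1) l (𝓝 z))
    {j : Fin m} (hj : 0 < lam j) (hlam : Tendsto (fun i => (p i).2 j) l (𝓝 (lam j))) :
    (fun i => inner ℝ (P.g j z) ((p i).1 - z)) =o[l] fun i => (p i).1 - z := by
  have hfd := ((hcon j).differentiable (by norm_num) z).hasGradientAt.hasFDerivAt.isLittleO
  refine ((hfd.comp_tendsto hx).neg_left).congr' ?_ .rfl
  filter_upwards [hp, hlam.eventually (lt_mem_nhds hj)] with i hi hpos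
  have hy : P.con j (p i).1 = 0 := (mul_eq_zero.1 (hi.complementary j)).resolve_left hpos.ne'
  have hz : P.con j z = 0 := (mul_eq_zero.1 (h.complementary j)).resolve_left hj.ne'
  simp [hy, hz, g]

theorem IsKKTPair.eventually_eq (h : P.IsKKTPair z lam) (hss : P.StrongSecondOrder z lam)
    (hindep : P.GradientsIndependent) (hobj : ContDiff ℝ 2 P.obj)
    (hcon : ∀ j, ContDiff ℝ 2 (P.con j)) : ∀ᶠ y in 𝓝 z, ∀ mu, P.IsKKTPair y mu → y = z := by
  let l : Filter (EuclideanSpace ℝ (Fin n) × (Fin m → ℝ)) :=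
    comap Prod.fst (𝓝 z) ⊓ 𝓟 {p | P.IsKKTPair p.1 p.2}
  have hx : Tendsto Prod.fst l (𝓝 z) := tendsto_comap.mono_left inf_le_left
  have hp : ∀ᶠ p in l, P.IsKKTPair p.1 p.2 := mem_inf_of_right (mem_principal_self _)
  have hmu : ∀ j, Tendsto (fun p => p.2 j) l (𝓝 (lam j)) :=
    h.tendsto_multiplier hindep hobj hcon hx
      (tendsto_const_nhds.congr' (hp.mono fun p hp => hp.phi_eq_zero.symm))
      (tendsto_const_nhds.congr' (hp.mono fun p hp => hp.stationary.symm))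
      fun j => tendsto_const_nhds.congr' (hp.mono fun p hp => by
        simp only [hp.fbar_eq, hp.complementary])
  set G := gradient (P.lagrangian lam)
  have hG : (fun p => G p.1 - G z - P.hessL z lam (p.1 - z)) =o[l] fun p => p.1 - z :=
    (((contDiff_gradient (contDiff_lagrangian hobj hcon lam) (k := 1)
      (by norm_num)).differentiable (by norm_num) z).hasFDerivAt.isLittleO).comp_tendsto hx
  have hsum : (fun p => ∑ j, (p.2 j - lam j) *
      (P.con j p.1 - P.con j z - inner ℝ (P.g j p.1) (p.1 - z))) =o[l]
      fun p => ‖p.1 - z‖ ^ 2 := .fun_sum fun j _ =>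
    (((Asymptotics.isLittleO_one_iff ℝ).2 (tendsto_sub_nhds_zero_iff.2 (hmu j))).mul_isBigO
      ((isBigO_sub_sub_inner_gradient (hcon j) z).comp_tendsto hx)).congr_right
      fun _ => one_mul _
  have hinner : (fun p => inner ℝ (p.1 - z) (G p.1 - G z - P.hessL z lam (p.1 - z))) =o[l]
      fun p => ‖p.1 - z‖ ^ 2 :=
    (isLittleO_inner (Asymptotics.isBigO_refl _ l).norm_right hG.norm_right).congr_right
      fun _ => (sq _).symm
  have hzero : ∀ᶠ p in l, p.1 - z = 0 := by
    refine eventually_eq_zero_of_inner_le (J := {j | 0 < lam j}) (v := fun j => P.g j z) hss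
      (fun j hj => h.isLittleO_inner_g hcon hp hx hj (hmu j)) (hsum.sub hinner) ?_
    filter_upwards [hp] with p hp
    have hle := h.inner_gradient_lagrangian_le hp hobj hcon
    have hGz : G z = 0 := h.gradient_lagrangian_eq_zero hobj hcon
    rw [hGz, sub_zero, inner_sub_right]
    linarith
  rw [eventually_inf_principal, eventually_comap] at hzero
  filter_upwards [hzero] with y hy mu hmu
  exact sub_eq_zero.1 (hy (y, mu) rfl hmu)

end KKTPairs

section Convergence

variable {n m : ℕ} {P : NLProblem n m} {A : AlgParams} {R : P.Run A} {a M : ℝ}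
  {z : EuclideanSpace ℝ (Fin n)} {lam : Fin m → ℝ}

theorem IsQPMultiplier.mul_fbar_eq {x d : EuclideanSpace ℝ (Fin n)}
    {B : Matrix (Fin n) (Fin n) ℝ} (h : P.IsQPMultiplier x B d lam) (j : Fin m) :
    lam j * P.fbar j x = -(lam j * inner ℝ (P.g j x) d) := by
  rw [eq_neg_iff_add_eq_zero, ← mul_add, h.complementary j]

namespace Run.Bounded

theorem abs_inner_g_d0_le (h : R.Bounded a M) (k : ℕ) (j : Fin m) :
    |inner ℝ (P.g j (R.x k)) (R.d0 k)| ≤ M * ‖R.d0 k‖ :=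
  (abs_real_inner_le_norm _ _).trans
    (mul_le_mul_of_nonneg_right (h.norm_g k j) (norm_nonneg _))

theorem norm_sum_lam_smul_g_le (h : R.Bounded a M) (k : ℕ) :
    ‖∑ j, R.lam k j • P.g j (R.x k)‖ ≤ M + M * M := by
  have hsum : ∑ j, R.lam k j • P.g j (R.x k) = -(P.g0 (R.x k) + matVec (R.B k) (R.d0 k)) := by
    rw [eq_neg_iff_add_eq_zero, add_comm, (R.step1_multiplier k).stationary]
  rw [hsum, norm_neg]
  exact (norm_add_le _ _).trans (add_le_add (h.norm_g0 k) ((h.norm_matVec k _).trans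
    (mul_le_mul_of_nonneg_left (h.norm_d0 k) h.pos.le)))

theorem sum_sq_fbar_mul_lam_le (h : R.Bounded a M) (k : ℕ) :
    ∑ j, (P.fbar j (R.x k) * R.lam k j) ^ 2 ≤
      (M * ‖R.d0 k‖) ^ 2 * ‖WithLp.toLp 2 (R.lam k)‖ ^ 2 := by
  rw [EuclideanSpace.norm_sq_eq, Finset.mul_sum]
  refine Finset.sum_le_sum fun j _ => ?_
  rw [mul_comm, (R.step1_multiplier k).mul_fbar_eq, neg_sq, mul_pow, mul_comm, Real.norm_eq_abs,
    sq_abs]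
  exact mul_le_mul_of_nonneg_right (sq_le_sq.2 ((h.abs_inner_g_d0_le k j).trans (le_abs_self _)))
    (sq_nonneg _)

variable (hindep : P.GradientsIndependent) (hobj : ContDiff ℝ 2 P.obj)
  (hcon : ∀ j, ContDiff ℝ 2 (P.con j))

include hobj hcon

theorem tendsto_inner_g_d0 (h : R.Bounded a M) (j : Fin m) :
    Tendsto (fun k => inner ℝ (P.g j (R.x k)) (R.d0 k)) atTop (𝓝 0) :=
  squeeze_zero_norm (fun k => h.abs_inner_g_d0_le k j)
    (by simpa using (h.tendsto_norm_d0 hobj hcon).const_mul M)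

theorem tendsto_stationarity (h : R.Bounded a M) :
    Tendsto (fun k => P.g0 (R.x k) + ∑ j, R.lam k j • P.g j (R.x k)) atTop (𝓝 0) := by
  refine squeeze_zero_norm (a := fun k => M * ‖R.d0 k‖) (fun k => ?_)
    (by simpa using (h.tendsto_norm_d0 hobj hcon).const_mul M)
  have hstat : P.g0 (R.x k) + ∑ j, R.lam k j • P.g j (R.x k) = -matVec (R.B k) (R.d0 k) := by
    rw [eq_neg_iff_add_eq_zero, ← (R.step1_multiplier k).stationary]
    abel
  rw [hstat, norm_neg]
  exact h.norm_matVec k _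

include hindep

theorem eventually_norm_lam_le (h : R.Bounded a M) : ∃ Λ, ∀ᶠ k in atTop, ‖R.lam k‖ ≤ Λ := by
  obtain ⟨c, hc, hgram⟩ := exists_gram_lower_bound (continuous_g hcon)
    (fun j => (hcon j).continuous) hindep
    (isCompact_closedBall (0 : EuclideanSpace ℝ (Fin n)) M)
  have hsmall : ∀ᶠ k in atTop, (M * ‖R.d0 k‖) ^ 2 < c / 2 := by
    have hlim : Tendsto (fun k => (M * ‖R.d0 k‖) ^ 2) atTop (𝓝 0) := by
      simpa using ((h.tendsto_norm_d0 hobj hcon).const_mul M).pow 2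
    exact hlim.eventually (gt_mem_nhds (half_pos hc))
  refine ⟨√((M + M * M) ^ 2 * 2 / c), hsmall.mono fun k hk => ?_⟩
  have hlam : ‖WithLp.toLp 2 (R.lam k)‖ ≤ √((M + M * M) ^ 2 * 2 / c) := by
    refine Real.le_sqrt_of_sq_le ((le_div_iff₀ hc).2 ?_)
    have hgram := hgram (R.x k) (by simpa using h.norm_x k) (WithLp.toLp 2 (R.lam k))
    have hsum := pow_le_pow_left₀ (norm_nonneg _) (h.norm_sum_lam_smul_g_le k) 2
    have hcompl := (h.sum_sq_fbar_mul_lam_le k).trans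
      (mul_le_mul_of_nonneg_right hk.le (sq_nonneg _))
    dsimp only at hgram
    linarith
  exact (pi_norm_le_iff_of_nonneg (Real.sqrt_nonneg _)).2 fun j =>
    (abs_apply_le_norm_toLp _ j).trans hlam

theorem tendsto_lam_mul_fbar (h : R.Bounded a M) (j : Fin m) :
    Tendsto (fun k => R.lam k j * P.fbar j (R.x k)) atTop (𝓝 0) := by
  obtain ⟨Λ, hΛ⟩ := h.eventually_norm_lam_le hindep hobj hcon
  have hlim : Tendsto (fun k => Λ * |inner ℝ (P.g j (R.x k)) (R.d0 k)|) atTop (𝓝 0) := by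
    simpa using (h.tendsto_inner_g_d0 hobj hcon j).abs.const_mul Λ
  refine squeeze_zero_norm' (hΛ.mono fun k hk => ?_) hlim
  rw [(R.step1_multiplier k).mul_fbar_eq, norm_neg, norm_mul]
  exact mul_le_mul_of_nonneg_right ((norm_le_pi_norm _ j).trans hk) (norm_nonneg _)

theorem exists_isKKTPair (h : R.Bounded a M) (hz : MapClusterPt z atTop R.x) :
    ∃ lam, P.IsKKTPair z lam := by
  obtain ⟨U, hU, hUx⟩ := mapClusterPt_iff_ultrafilter.1 hz
  obtain ⟨Λ, hΛ⟩ := h.eventually_norm_lam_le hindep hobj hcon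
  have hmem : ∀ᶠ k in (U : Filter ℕ), R.lam k ∈ Metric.closedBall (0 : Fin m → ℝ) Λ :=
    (Eventually.filter_mono hU hΛ).mono fun k hk => mem_closedBall_zero_iff.2 hk
  obtain ⟨lam, -, hlam : Tendsto R.lam U (𝓝 lam)⟩ :=
    (isCompact_closedBall (0 : Fin m → ℝ) Λ).ultrafilter_le_nhds (U.map R.lam)
      (le_principal_iff.2 hmem)
  have hlamj : ∀ j, Tendsto (fun k => R.lam k j) U (𝓝 (lam j)) := tendsto_pi_nhds.1 hlam
  have hφ := (h.tendsto_phi hobj hcon).mono_left hU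
  refine ⟨lam, ?_, fun j => ?_, fun j => ?_, fun j => ?_⟩
  · refine tendsto_nhds_unique ?_ ((h.tendsto_stationarity hobj hcon).mono_left hU)
    exact (((continuous_g0 hobj).tendsto z).comp hUx).add (tendsto_finsetSum _ fun j _ =>
      (hlamj j).smul (((continuous_g hcon j).tendsto z).comp hUx))
  · exact le_of_tendsto_of_tendsto' (((hcon j).continuous.tendsto z).comp hUx) hφ
      fun k => con_le_phi j _
  · exact ge_of_tendsto' (hlamj j) fun k => (R.step1_multiplier k).nonneg j
  · exact tendsto_nhds_unique
      ((hlamj j).mul (tendsto_fbar (fun j => (hcon j).continuous) hUx hφ j))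
      ((h.tendsto_lam_mul_fbar hindep hobj hcon j).mono_left hU)

theorem tendsto_x (h : R.Bounded a M) (hz : MapClusterPt z atTop R.x) (hkkt : P.IsKKTPair z lam)
    (hss : P.StrongSecondOrder z lam) : Tendsto R.x atTop (𝓝 z) := by
  refine tendsto_of_isolated_mapClusterPt (h.tendsto_increment hobj hcon) hz ?_
  filter_upwards [hkkt.eventually_eq hss hindep hobj hcon] with y hy hcluster
  obtain ⟨mu, hmu⟩ := h.exists_isKKTPair hindep hobj hcon hcluster
  exact hy mu hmu

theorem tendsto_lam (h : R.Bounded a M) (hkkt : P.IsKKTPair z lam) (hx : Tendsto R.x atTop (𝓝 z))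
    (j : Fin m) : Tendsto (fun k => R.lam k j) atTop (𝓝 (lam j)) :=
  hkkt.tendsto_multiplier hindep hobj hcon hx (h.tendsto_phi hobj hcon)
    (h.tendsto_stationarity hobj hcon) (h.tendsto_lam_mul_fbar hindep hobj hcon) j

end Run.Bounded

end Convergence

end NLProblem

section Powers

open Asymptotics

theorem isLittleO_rpow_rpow_of_lt {ι : Type*} {l : Filter ι} {u : ι → ℝ} {r s : ℝ}
    (hu0 : ∀ i, 0 ≤ u i) (hu : Tendsto u l (𝓝 0)) (hs : 0 ≤ s) (hsr : s < r) :
    (fun i => u i ^ r) =o[l] fun i => u i ^ s := by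
  have hpow : Tendsto (fun i => u i ^ (r - s)) l (𝓝 0) := by
    simpa [Real.zero_rpow (sub_pos.2 hsr).ne'] using
      hu.rpow_const (p := r - s) (Or.inr (sub_pos.2 hsr).le)
  refine (((isLittleO_one_iff ℝ).2 hpow).mul_isBigO (isBigO_refl (fun i => u i ^ s) l)).congr
    (fun i => ?_) fun i => one_mul _
  rw [← Real.rpow_add_of_nonneg (hu0 i) (sub_pos.2 hsr).le hs, sub_add_cancel]

theorem isLittleO_mul_of_tendsto_zero {ι : Type*} {l : Filter ι} {u v e : ι → ℝ}
    (hu : Tendsto u l (𝓝 0)) (hv : v =O[l] e) : (fun i => u i * v i) =o[l] e := by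
  simpa using ((isLittleO_one_iff ℝ).2 hu).mul_isBigO hv

theorem isLittleO_mul_of_isBigO_one {ι : Type*} {l : Filter ι} {u v e : ι → ℝ}
    (hu : u =O[l] fun _ => (1 : ℝ)) (hv : v =o[l] e) : (fun i => u i * v i) =o[l] e := by
  simpa using hu.mul_isLittleO hv

end Powers

namespace NLProblem

variable {n m : ℕ} {P : NLProblem n m} {A : AlgParams} {R : P.Run A} {a M : ℝ}

open Asymptotics

section Residual

theorem Run.isBigO_sq_norm_d0 (R : P.Run A) (s : ℝ) :
    (fun k => ‖R.d0 k‖ ^ 2) =O[atTop] R.residual s :=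
  .of_norm_le fun k => by
    rw [Real.norm_of_nonneg (sq_nonneg _)]
    exact le_add_of_nonneg_right (rpow_phi_nonneg _ _)

theorem Run.isBigO_rpow_phi (R : P.Run A) (s : ℝ) :
    (fun k => P.phi (R.x k) ^ s) =O[atTop] R.residual s :=
  .of_norm_le fun k => by
    rw [Real.norm_of_nonneg (rpow_phi_nonneg _ _)]
    exact le_add_of_nonneg_left (sq_nonneg _)

theorem Run.isBigO_rpow_tau (R : P.Run A) :
    (fun k => ‖R.d0 k‖ ^ A.tau) =O[atTop]
      fun k => ‖R.d0 k‖ ^ A.tau + P.phi (R.x k) ^ A.sigma :=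
  .of_norm_le fun k => by
    rw [Real.norm_of_nonneg (Real.rpow_nonneg (norm_nonneg _) _)]
    exact le_add_of_nonneg_right (rpow_phi_nonneg _ _)

theorem Run.isBigO_rpow_sigma (R : P.Run A) :
    (fun k => P.phi (R.x k) ^ A.sigma) =O[atTop]
      fun k => ‖R.d0 k‖ ^ A.tau + P.phi (R.x k) ^ A.sigma :=
  .of_norm_le fun k => by
    rw [Real.norm_of_nonneg (rpow_phi_nonneg _ _)]
    exact le_add_of_nonneg_left (Real.rpow_nonneg (norm_nonneg _) _)

theorem Run.isLittleO_rpow_norm {v : ℕ → EuclideanSpace ℝ (Fin n)} {r s : ℝ} (hr : 2 < r)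
    (hv : Tendsto (fun k => ‖v k‖) atTop (𝓝 0))
    (hsq : (fun k => ‖v k‖ ^ 2) =O[atTop] R.residual s) :
    (fun k => ‖v k‖ ^ r) =o[atTop] R.residual s := by
  have hpow := isLittleO_rpow_rpow_of_lt (fun _ => norm_nonneg _) hv zero_le_two hr
  simp only [Real.rpow_two] at hpow
  exact hpow.trans_isBigO hsq

namespace Run.Bounded

variable (hobj : ContDiff ℝ 2 P.obj) (hcon : ∀ j, ContDiff ℝ 2 (P.con j)) {s : ℝ}

include hobj hcon

theorem tendsto_norm_direction (h : R.Bounded a M) :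
    Tendsto (fun k => ‖R.d0 k + R.d1 k‖) atTop (𝓝 0) :=
  squeeze_zero (fun _ => norm_nonneg _) (fun _ => norm_add_le _ _)
    (by simpa using (h.tendsto_norm_d0 hobj hcon).add (h.tendsto_norm_d1 hobj hcon))

theorem isLittleO_rpow_sigma (h : R.Bounded a M) (hs : 0 ≤ s) (hsσ : s < A.sigma) :
    (fun k => P.phi (R.x k) ^ A.sigma) =o[atTop] R.residual s :=
  (isLittleO_rpow_rpow_of_lt (fun _ => phi_nonneg _) (h.tendsto_phi hobj hcon) hs hsσ).trans_isBigO
    (R.isBigO_rpow_phi s)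

theorem isBigO_norm_d1 (h : R.Bounded a M) :
    (fun k => ‖R.d1 k‖) =O[atTop] R.residual A.sigma := by
  obtain ⟨C, -, hC⟩ := h.exists_correction_bound hobj hcon
  refine .of_bound C (.of_forall fun k => ?_)
  rw [norm_norm, Real.norm_of_nonneg (R.residual_nonneg _ _)]
  exact (hC k).1

theorem isBigO_norm_d1_of_lt (h : R.Bounded a M) (hs : 0 ≤ s) (hsσ : s < A.sigma) :
    (fun k => ‖R.d1 k‖) =O[atTop] R.residual s :=
  (h.isBigO_norm_d1 hobj hcon).trans
    ((R.isBigO_sq_norm_d0 s).add (h.isLittleO_rpow_sigma hobj hcon hs hsσ).isBigO)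

theorem isLittleO_sq_norm_d1 (h : R.Bounded a M) (hs : 0 ≤ s) (hsσ : s < A.sigma) :
    (fun k => ‖R.d1 k‖ ^ 2) =o[atTop] R.residual s := by
  simpa only [sq] using isLittleO_mul_of_tendsto_zero (h.tendsto_norm_d1 hobj hcon)
    (h.isBigO_norm_d1_of_lt hobj hcon hs hsσ)

theorem isBigO_sq_norm_direction (h : R.Bounded a M) (hs : 0 ≤ s) (hsσ : s < A.sigma) :
    (fun k => ‖R.d0 k + R.d1 k‖ ^ 2) =O[atTop] R.residual s := by
  refine (IsBigO.of_bound 2 (.of_forall fun k => ?_)).trans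
    ((R.isBigO_sq_norm_d0 s).add (h.isLittleO_sq_norm_d1 hobj hcon hs hsσ).isBigO)
  rw [Real.norm_of_nonneg (by positivity), Real.norm_of_nonneg (by positivity)]
  calc ‖R.d0 k + R.d1 k‖ ^ 2 ≤ (‖R.d0 k‖ + ‖R.d1 k‖) ^ 2 := by gcongr; exact norm_add_le _ _
    _ ≤ 2 * (‖R.d0 k‖ ^ 2 + ‖R.d1 k‖ ^ 2) := add_sq_le

end Run.Bounded

end Residual

namespace Run.Bounded

section Step2

theorem eventually_step2Test (h : R.Bounded a M) (hobj : ContDiff ℝ 2 P.obj)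
    (hcon : ∀ j, ContDiff ℝ 2 (P.con j)) :
    ∀ᶠ k in atTop, P.Step2Test A (R.x k) (R.d0 k) (R.d0 k + R.d1 k) := by
  have hsmall : ∀ {v : ℕ → EuclideanSpace ℝ (Fin n)}, Tendsto (fun k => ‖v k‖) atTop (𝓝 0) →
      (fun k => ‖v k‖ ^ 2) =O[atTop] R.residual A.varrho → ∀ᶠ k in atTop,
        A.zeta * ‖v k‖ ^ A.delta ≤ a * ‖R.d0 k‖ ^ 2 + A.xi * P.phi (R.x k) ^ A.varrho := by
    intro v hv hsq
    filter_upwards [((isLittleO_rpow_norm A.two_lt_delta hv hsq).const_mul_left A.zeta).bound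
      (lt_min h.a_pos A.xi_pos)] with k hk
    rw [Real.norm_of_nonneg (mul_nonneg A.zeta_pos.le (Real.rpow_nonneg (norm_nonneg _) _)),
      Real.norm_of_nonneg (R.residual_nonneg _ k), residual, mul_add] at hk
    refine hk.trans (add_le_add ?_ ?_)
    · exact mul_le_mul_of_nonneg_right (min_le_left _ _) (sq_nonneg _)
    · exact mul_le_mul_of_nonneg_right (min_le_right _ _) (rpow_phi_nonneg _ _)
  filter_upwards [hsmall (h.tendsto_norm_d0 hobj hcon) (R.isBigO_sq_norm_d0 _),
    hsmall (h.tendsto_norm_direction hobj hcon)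
      (h.isBigO_sq_norm_direction hobj hcon A.varrho_pos.le A.varrho_lt_sigma)] with k hd0 hd
  rw [Step2Test, mul_min_of_nonneg _ _ A.zeta_pos.le]
  have hmin : -(a * ‖R.d0 k‖ ^ 2 + A.xi * P.phi (R.x k) ^ A.varrho) ≤
      min (A.zeta * -(‖R.d0 k‖ ^ A.delta)) (A.zeta * -(‖R.d0 k + R.d1 k‖ ^ A.delta)) :=
    le_min (by linarith) (by linarith)
  linarith [h.inner_g0_le k]

end Step2

section ConstraintDecrease

theorem diagD_le_slack (h : R.Bounded a M) (k : ℕ) (j : Fin m) :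
    P.diagD (R.x k) (R.d0 k) j ≤
      2 * M * -(P.fbar j (R.x k) + inner ℝ (P.g j (R.x k)) (R.d0 k)) + M ^ 2 * ‖R.d0 k‖ := by
  have hslack := (R.step1_solution k).1 j
  have hfbar : |P.fbar j (R.x k)| ≤
      -(P.fbar j (R.x k) + inner ℝ (P.g j (R.x k)) (R.d0 k)) + M * ‖R.d0 k‖ := by
    rw [abs_of_nonpos (fbar_nonpos j _)]
    linarith [(abs_le.1 (h.abs_inner_g_d0_le k j)).2]
  rw [diagD, abs_of_nonpos hslack, mul_add]
  have hM := h.pos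
  have hd0M := h.norm_d0 k
  set s := -(P.fbar j (R.x k) + inner ℝ (P.g j (R.x k)) (R.d0 k))
  have hs : 0 ≤ s := neg_nonneg.2 hslack
  calc |P.fbar j (R.x k)| * s + |P.fbar j (R.x k)| * ‖R.d0 k‖
      ≤ M * s + (s + M * ‖R.d0 k‖) * ‖R.d0 k‖ := by
        gcongr
        exact h.abs_fbar_le k j
    _ = M * s + (s * ‖R.d0 k‖ + M * ‖R.d0 k‖ * ‖R.d0 k‖) := by ring
    _ ≤ M * s + (s * M + M * ‖R.d0 k‖ * M) := by gcongr
    _ = _ := by ring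

variable (hobj : ContDiff ℝ 2 P.obj) (hcon : ∀ j, ContDiff ℝ 2 (P.con j))

include hobj hcon

theorem eventually_diagD_mul_h1_le (h : R.Bounded a M) :
    ∃ C > 0, ∀ᶠ k in atTop, ∀ j, P.diagD (R.x k) (R.d0 k) j * R.h1 k j ≤
      -(P.fbar j (R.x k) + inner ℝ (P.g j (R.x k)) (R.d0 k)) +
        C * (‖R.d0 k‖ * R.residual A.sigma k) := by
  have hM := h.pos
  obtain ⟨C, hC, hd1⟩ := h.exists_correction_bound hobj hcon
  have hlim : Tendsto (fun k => 2 * M * C * R.residual A.sigma k) atTop (𝓝 0) := by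
    simpa using (h.tendsto_residual hobj hcon A.sigma_pos).const_mul (2 * M * C)
  refine ⟨M ^ 2 * C, by positivity, ?_⟩
  filter_upwards [hlim.eventually (ge_mem_nhds one_pos)] with k hk j
  have hs : 0 ≤ -(P.fbar j (R.x k) + inner ℝ (P.g j (R.x k)) (R.d0 k)) :=
    neg_nonneg.2 ((R.step1_solution k).1 j)
  have hD := h.diagD_le_slack k j
  set s := -(P.fbar j (R.x k) + inner ℝ (P.g j (R.x k)) (R.d0 k))
  calc P.diagD (R.x k) (R.d0 k) j * R.h1 k j
      ≤ (2 * M * s + M ^ 2 * ‖R.d0 k‖) * (C * R.residual A.sigma k) :=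
        mul_le_mul_of_nonneg hD ((le_abs_self _).trans ((hd1 k).2 j)) (diagD_nonneg _ _ _)
          (mul_nonneg hC.le (R.residual_nonneg _ k))
    _ = 2 * M * C * R.residual A.sigma k * s +
          M ^ 2 * C * (‖R.d0 k‖ * R.residual A.sigma k) := by ring
    _ ≤ 1 * s + M ^ 2 * C * (‖R.d0 k‖ * R.residual A.sigma k) := by gcongr
    _ = _ := by rw [one_mul]

theorem eventually_con_direction_le (h : R.Bounded a M) :
    ∃ C ≥ 0, ∀ᶠ k in atTop, ∀ j, P.con j (R.x k + (R.d0 k + R.d1 k)) ≤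
      P.con j (R.x k + R.d0 k) + inner ℝ (P.g j (R.x k)) (R.d1 k) +
        C * (‖R.d0 k‖ * ‖R.d1 k‖ + ‖R.d1 k‖ ^ 2) := by
  obtain ⟨C, hC, htaylor⟩ := exists_taylor_bound_closedBall hobj hcon (M + M + 1)
  have hM := h.pos
  refine ⟨C, hC, ?_⟩
  filter_upwards [(h.tendsto_norm_d1 hobj hcon).eventually (ge_mem_nhds one_pos)] with k hd1 j
  have hxd0 : ‖R.x k + R.d0 k‖ ≤ M + M := norm_add_le_of_le (h.norm_x k) (h.norm_d0 k)
  have hgrad := ((htaylor (R.x k) (R.d0 k) (by linarith [h.norm_x k]) (by linarith)).2 j).1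
  have hrem := ((htaylor (R.x k + R.d0 k) (R.d1 k) (by linarith)
    (norm_add_le_of_le hxd0 hd1)).2 j).2
  have hinner : inner ℝ (P.g j (R.x k + R.d0 k) - P.g j (R.x k)) (R.d1 k) ≤
      C * ‖R.d0 k‖ * ‖R.d1 k‖ :=
    (real_inner_le_norm _ _).trans (mul_le_mul_of_nonneg_right hgrad (norm_nonneg _))
  rw [inner_sub_left] at hinner
  rw [← add_assoc]
  linarith [(abs_le.1 hrem).2]

theorem eventually_con_direction_le_residual (h : R.Bounded a M) :
    ∃ C > 0, ∀ᶠ k in atTop, ∀ j, P.con j (R.x k + (R.d0 k + R.d1 k)) ≤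
      P.con j (R.x k) - P.fbar j (R.x k) - (‖R.d0 k‖ ^ A.tau + P.phi (R.x k) ^ A.sigma) +
        C * (‖R.d0 k‖ * R.residual A.sigma k + R.residual A.sigma k ^ 2) := by
  obtain ⟨C₁, hC₁, hd1⟩ := h.exists_correction_bound hobj hcon
  obtain ⟨C₂, hC₂, hdiag⟩ := h.eventually_diagD_mul_h1_le hobj hcon
  obtain ⟨C₃, hC₃, htaylor⟩ := h.eventually_con_direction_le hobj hcon
  refine ⟨C₂ + C₃ * (C₁ + C₁ ^ 2), by positivity, ?_⟩
  filter_upwards [hdiag, htaylor] with k hDh hcon j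
  have hlin := (R.step2_correction k).linearized j
  rw [rhsCorrection] at hlin
  have hres := R.residual_nonneg A.sigma k
  have herr : C₃ * (‖R.d0 k‖ * ‖R.d1 k‖ + ‖R.d1 k‖ ^ 2) ≤
      C₃ * (‖R.d0 k‖ * (C₁ * R.residual A.sigma k) + (C₁ * R.residual A.sigma k) ^ 2) := by
    have hd1 := (hd1 k).1
    gcongr
  have hslack : 0 ≤ (C₂ + C₃ * C₁) * R.residual A.sigma k ^ 2 +
      C₃ * C₁ ^ 2 * (‖R.d0 k‖ * R.residual A.sigma k) := by positivity
  linarith [hcon j, hDh j]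

theorem isLittleO_norm_d0_mul_residual (h : R.Bounded a M) :
    (fun k => ‖R.d0 k‖ * R.residual A.sigma k) =o[atTop]
      fun k => ‖R.d0 k‖ ^ A.tau + P.phi (R.x k) ^ A.sigma := by
  have hd0 := h.tendsto_norm_d0 hobj hcon
  have hcube : (fun k => ‖R.d0 k‖ ^ (3 : ℝ)) =o[atTop] fun k => ‖R.d0 k‖ ^ A.tau :=
    isLittleO_rpow_rpow_of_lt (fun _ => norm_nonneg _) hd0 (zero_le_two.trans A.tau_mem.1.le)
      A.tau_mem.2
  refine ((hcube.trans_isBigO R.isBigO_rpow_tau).add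
    (isLittleO_mul_of_tendsto_zero hd0 R.isBigO_rpow_sigma)).congr_left fun k => ?_
  rw [Real.rpow_ofNat, residual]
  ring

theorem isLittleO_sq_residual (h : R.Bounded a M) :
    (fun k => R.residual A.sigma k ^ 2) =o[atTop]
      fun k => ‖R.d0 k‖ ^ A.tau + P.phi (R.x k) ^ A.sigma := by
  refine ((isLittleO_mul_of_tendsto_zero (h.tendsto_norm_d0 hobj hcon)
    (h.isLittleO_norm_d0_mul_residual hobj hcon).isBigO).add
    (isLittleO_mul_of_tendsto_zero (h.tendsto_residual hobj hcon A.sigma_pos)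
      R.isBigO_rpow_sigma)).congr_left fun k => ?_
  rw [residual]
  ring

theorem eventually_constraint_decrease (h : R.Bounded a M) :
    ∀ᶠ k in atTop, ∀ j, P.con j (R.x k + (R.d0 k + R.d1 k)) ≤ P.con j (R.x k) -
      P.fbar j (R.x k) - A.alpha * (‖R.d0 k‖ ^ A.tau + P.phi (R.x k) ^ A.sigma) := by
  obtain ⟨C, -, hcon'⟩ := h.eventually_con_direction_le_residual hobj hcon
  have hα : A.alpha < 1 := A.alpha_mem.2.trans one_half_lt_one
  have herr := ((h.isLittleO_norm_d0_mul_residual hobj hcon).add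
    (h.isLittleO_sq_residual hobj hcon)).const_mul_left C
  filter_upwards [hcon', herr.bound (sub_pos.2 hα)] with k hcon hk j
  rw [Real.norm_of_nonneg (add_nonneg (Real.rpow_nonneg (norm_nonneg _) _)
    (rpow_phi_nonneg _ _))] at hk
  linarith [hcon j, (le_abs_self _).trans hk]

end ConstraintDecrease

end Run.Bounded

end NLProblem

open Asymptotics in
theorem isLittleO_taylor_remainder_of_tendsto {E ι : Type*} [NormedAddCommGroup E]
    [InnerProductSpace ℝ E] [CompleteSpace E] {f : E → ℝ} {l : Filter ι} {x d : ι → E} {z : E}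
    (hf : ContDiff ℝ 2 f) (hx : Tendsto x l (𝓝 z)) (hd : Tendsto (fun i => ‖d i‖) l (𝓝 0)) :
    (fun i => f (x i + d i) - f (x i) - inner ℝ (gradient f (x i)) (d i) -
      1 / 2 * inner ℝ (d i) (fderiv ℝ (gradient f) z (d i))) =o[l] fun i => ‖d i‖ ^ 2 :=
  (isLittleO_taylor_remainder hf z).comp_tendsto
    (hx.prodMk_nhds (tendsto_zero_iff_norm_tendsto_zero.2 hd))

namespace NLProblem

open Asymptotics

variable {n m : ℕ} {P : NLProblem n m} {A : AlgParams} {R : P.Run A} {a M : ℝ}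
  {z : EuclideanSpace ℝ (Fin n)} {lam : Fin m → ℝ}

section ObjectiveExpansion

theorem hessL_apply (hobj : ContDiff ℝ 2 P.obj) (hcon : ∀ j, ContDiff ℝ 2 (P.con j))
    (lam : Fin m → ℝ) (x d : EuclideanSpace ℝ (Fin n)) :
    P.hessL x lam d = fderiv ℝ P.g0 x d + ∑ j, lam j • fderiv ℝ (P.g j) x d := by
  have hg0 : DifferentiableAt ℝ P.g0 x :=
    (contDiff_gradient hobj (k := 1) (by norm_num)).differentiable (by norm_num) x
  have hg : ∀ j, DifferentiableAt ℝ (P.g j) x := fun j =>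
    (contDiff_gradient (hcon j) (k := 1) (by norm_num)).differentiable (by norm_num) x
  have hsum : HasFDerivAt (fun y => P.g0 y + ∑ j, lam j • P.g j y)
      (fderiv ℝ P.g0 x + ∑ j, lam j • fderiv ℝ (P.g j) x) x :=
    hg0.hasFDerivAt.add (HasFDerivAt.fun_sum fun j _ => (hg j).hasFDerivAt.const_smul (lam j))
  rw [hessL, gradient_lagrangian hobj hcon, hsum.fderiv]
  simp

theorem Run.isBigO_inner_d0 (R : P.Run A) (s : ℝ)
    (H : EuclideanSpace ℝ (Fin n) →L[ℝ] EuclideanSpace ℝ (Fin n)) :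
    (fun k => inner ℝ (R.d0 k) (H (R.d0 k))) =O[atTop] R.residual s := by
  refine (IsBigO.of_bound ‖H‖ (.of_forall fun k => ?_)).trans (R.isBigO_sq_norm_d0 s)
  rw [Real.norm_of_nonneg (sq_nonneg _)]
  calc ‖inner ℝ (R.d0 k) (H (R.d0 k))‖ ≤ ‖R.d0 k‖ * ‖H (R.d0 k)‖ := norm_inner_le_norm _ _
    _ ≤ ‖R.d0 k‖ * (‖H‖ * ‖R.d0 k‖) := by gcongr; exact H.le_opNorm _
    _ = ‖H‖ * ‖R.d0 k‖ ^ 2 := by ring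

theorem Run.inner_g0_d1_eq (R : P.Run A) (k : ℕ) : inner ℝ (P.g0 (R.x k)) (R.d1 k) =
    -inner ℝ (matVec (R.B k) (R.d0 k)) (R.d1 k) -
      ∑ j, R.lam k j * inner ℝ (P.g j (R.x k)) (R.d1 k) := by
  have hstat := congrArg (inner ℝ · (R.d1 k)) (R.step1_multiplier k).stationary
  simp only [inner_add_left, sum_inner, real_inner_smul_left, inner_zero_left] at hstat
  linarith

theorem Run.isLittleO_inner_model_error {s : ℝ}
    (hdm : (fun k => P.hessL z lam (R.d0 k) - matVec (R.B k) (R.d0 k)) =o[atTop] R.d0) :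
    (fun k => inner ℝ (R.d0 k) (P.hessL z lam (R.d0 k) - matVec (R.B k) (R.d0 k)))
      =o[atTop] R.residual s :=
  ((isLittleO_inner (isBigO_norm_right.2 (isBigO_refl R.d0 _)) hdm.norm_right).congr_right
    fun _ => (sq _).symm).trans_isBigO (R.isBigO_sq_norm_d0 s)

namespace Run.Bounded

theorem lam_mul_diagD_le (h : R.Bounded a M) (k : ℕ) (j : Fin m) :
    R.lam k j * P.diagD (R.x k) (R.d0 k) j ≤ M * (R.lam k j * ‖R.d0 k‖ ^ 2) := by
  have hmult := R.step1_multiplier k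
  rcases mul_eq_zero.1 (hmult.complementary j) with hlam | hactive
  · simp [hlam]
  · have hfbar : |P.fbar j (R.x k)| ≤ M * ‖R.d0 k‖ := by
      rw [eq_neg_of_add_eq_zero_left hactive, abs_neg]
      exact h.abs_inner_g_d0_le k j
    rw [diagD, hactive, abs_zero, zero_add]
    calc R.lam k j * (|P.fbar j (R.x k)| * ‖R.d0 k‖)
        ≤ R.lam k j * (M * ‖R.d0 k‖ * ‖R.d0 k‖) := by
          gcongr
          exact hmult.nonneg j
      _ = M * (R.lam k j * ‖R.d0 k‖ ^ 2) := by ring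

variable (hobj : ContDiff ℝ 2 P.obj) (hcon : ∀ j, ContDiff ℝ 2 (P.con j)) {s : ℝ}

include hobj hcon

theorem tendsto_h1 (h : R.Bounded a M) (j : Fin m) :
    Tendsto (fun k => R.h1 k j) atTop (𝓝 0) := by
  obtain ⟨C, -, hC⟩ := h.exists_correction_bound hobj hcon
  exact squeeze_zero_norm (fun k => (hC k).2 j)
    (by simpa using (h.tendsto_residual hobj hcon A.sigma_pos).const_mul C)

theorem isLittleO_lam_mul_diagD_mul_h1 (h : R.Bounded a M)
    (hlam : ∀ j, Tendsto (fun k => R.lam k j) atTop (𝓝 (lam j))) (j : Fin m) :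
    (fun k => R.lam k j * (P.diagD (R.x k) (R.d0 k) j * R.h1 k j)) =o[atTop] R.residual s := by
  have hlamD : (fun k => R.lam k j * P.diagD (R.x k) (R.d0 k) j) =O[atTop] R.residual s := by
    refine (IsBigO.of_bound M (.of_forall fun k => ?_)).trans
      ((((hlam j).isBigO_one ℝ).mul (R.isBigO_sq_norm_d0 s)).congr_right fun _ => one_mul _)
    have hnonneg := (R.step1_multiplier k).nonneg j
    rw [Real.norm_of_nonneg (mul_nonneg hnonneg (diagD_nonneg _ _ _)),
      Real.norm_of_nonneg (mul_nonneg hnonneg (sq_nonneg _))]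
    exact h.lam_mul_diagD_le k j
  exact (isLittleO_mul_of_tendsto_zero (h.tendsto_h1 hobj hcon j) hlamD).congr_left
    fun k => by ring

variable (hs : 0 ≤ s) (hsσ : s < A.sigma)

include hs hsσ

theorem isLittleO_norm_d0_mul_norm_d1 (h : R.Bounded a M) :
    (fun k => ‖R.d0 k‖ * ‖R.d1 k‖) =o[atTop] R.residual s :=
  isLittleO_mul_of_tendsto_zero (h.tendsto_norm_d0 hobj hcon)
    (h.isBigO_norm_d1_of_lt hobj hcon hs hsσ)

theorem isLittleO_inner_matVec_d0_d1 (h : R.Bounded a M) :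
    (fun k => inner ℝ (matVec (R.B k) (R.d0 k)) (R.d1 k)) =o[atTop] R.residual s := by
  refine (IsBigO.of_bound M (.of_forall fun k => ?_)).trans_isLittleO
    (h.isLittleO_norm_d0_mul_norm_d1 hobj hcon hs hsσ)
  rw [Real.norm_of_nonneg (by positivity : 0 ≤ ‖R.d0 k‖ * ‖R.d1 k‖), ← mul_assoc]
  exact (norm_inner_le_norm _ _).trans
    (mul_le_mul_of_nonneg_right (h.norm_matVec k _) (norm_nonneg _))

theorem isLittleO_inner_direction_sub (h : R.Bounded a M)
    (H : EuclideanSpace ℝ (Fin n) →L[ℝ] EuclideanSpace ℝ (Fin n)) :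
    (fun k => inner ℝ (R.d0 k + R.d1 k) (H (R.d0 k + R.d1 k)) -
      inner ℝ (R.d0 k) (H (R.d0 k))) =o[atTop] R.residual s := by
  refine (IsBigO.of_bound ‖H‖ (.of_forall fun k => ?_)).trans_isLittleO
    (((h.isLittleO_norm_d0_mul_norm_d1 hobj hcon hs hsσ).const_mul_left 2).add
      (h.isLittleO_sq_norm_d1 hobj hcon hs hsσ))
  have hbound : ∀ u v, |inner ℝ u (H v)| ≤ ‖H‖ * (‖u‖ * ‖v‖) := fun u v =>
    calc |inner ℝ u (H v)| ≤ ‖u‖ * ‖H v‖ := abs_real_inner_le_norm _ _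
      _ ≤ ‖u‖ * (‖H‖ * ‖v‖) := by gcongr; exact H.le_opNorm v
      _ = ‖H‖ * (‖u‖ * ‖v‖) := by ring
  have hcross : inner ℝ (R.d0 k + R.d1 k) (H (R.d0 k + R.d1 k)) - inner ℝ (R.d0 k) (H (R.d0 k)) =
      inner ℝ (R.d0 k) (H (R.d1 k)) + inner ℝ (R.d1 k) (H (R.d0 k)) +
        inner ℝ (R.d1 k) (H (R.d1 k)) := by
    simp only [map_add, inner_add_left, inner_add_right]
    ring
  rw [hcross, Real.norm_eq_abs, Real.norm_of_nonneg (by positivity)]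
  refine (abs_add_three _ _ _).trans ?_
  linarith [hbound (R.d0 k) (R.d1 k), hbound (R.d1 k) (R.d0 k), hbound (R.d1 k) (R.d1 k)]

theorem isLittleO_obj_direction (h : R.Bounded a M) (hx : Tendsto R.x atTop (𝓝 z)) :
    (fun k => P.obj (R.x k + (R.d0 k + R.d1 k)) - P.obj (R.x k) -
      inner ℝ (P.g0 (R.x k)) (R.d0 k + R.d1 k) -
      1 / 2 * inner ℝ (R.d0 k) (fderiv ℝ P.g0 z (R.d0 k))) =o[atTop] R.residual s := by
  have htaylor := (isLittleO_taylor_remainder_of_tendsto hobj hx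
    (h.tendsto_norm_direction hobj hcon)).trans_isBigO
    (h.isBigO_sq_norm_direction hobj hcon hs hsσ)
  have hquad := (h.isLittleO_inner_direction_sub hobj hcon hs hsσ
    (fderiv ℝ P.g0 z)).const_mul_left (1 / 2)
  refine (htaylor.add hquad).congr_left fun k => ?_
  rw [show P.g0 = gradient P.obj from rfl]
  ring

variable (hlam : ∀ j, Tendsto (fun k => R.lam k j) atTop (𝓝 (lam j)))

include hlam

theorem isLittleO_lam_mul_rhsCorrection (h : R.Bounded a M) (hx : Tendsto R.x atTop (𝓝 z))
    (j : Fin m) :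
    (fun k => R.lam k j * P.rhsCorrection A (R.x k) (R.d0 k) j +
      lam j * (1 / 2 * inner ℝ (R.d0 k) (fderiv ℝ (P.g j) z (R.d0 k)))) =o[atTop]
      R.residual s := by
  have hd0 := h.tendsto_norm_d0 hobj hcon
  have hpow := (isLittleO_rpow_norm A.tau_mem.1 hd0 (R.isBigO_sq_norm_d0 s)).add
    (h.isLittleO_rpow_sigma hobj hcon hs hsσ)
  have htaylor := (isLittleO_taylor_remainder_of_tendsto (hcon j) hx hd0).trans_isBigO
    (R.isBigO_sq_norm_d0 s)
  have hdiff := isLittleO_mul_of_tendsto_zero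
    (by simpa using (hlam j).sub_const (lam j) : Tendsto (fun k => R.lam k j - lam j) atTop (𝓝 0))
    ((R.isBigO_inner_d0 s (fderiv ℝ (P.g j) z)).const_mul_left (1 / 2))
  refine ((isLittleO_mul_of_isBigO_one ((hlam j).isBigO_one ℝ) (hpow.add htaylor)).add
    hdiff).neg_left.congr_left fun k => ?_
  rw [rhsCorrection, show P.g j = gradient (P.con j) from rfl]
  ring

theorem isLittleO_inner_g0_d1 (h : R.Bounded a M) (hx : Tendsto R.x atTop (𝓝 z)) :
    (fun k => inner ℝ (P.g0 (R.x k)) (R.d1 k) - 1 / 2 *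
      ∑ j, lam j * inner ℝ (R.d0 k) (fderiv ℝ (P.g j) z (R.d0 k))) =o[atTop] R.residual s := by
  have hsum := IsLittleO.sum (s := Finset.univ) fun j (_ : j ∈ Finset.univ) =>
    (h.isLittleO_lam_mul_rhsCorrection hobj hcon hs hsσ hlam hx j).add
      (h.isLittleO_lam_mul_diagD_mul_h1 hobj hcon hlam j)
  refine ((h.isLittleO_inner_matVec_d0_d1 hobj hcon hs hsσ).add hsum).neg_left.congr_left
    fun k => ?_
  have hlin : ∀ j, R.lam k j * inner ℝ (P.g j (R.x k)) (R.d1 k) =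
      R.lam k j * P.rhsCorrection A (R.x k) (R.d0 k) j +
        R.lam k j * (P.diagD (R.x k) (R.d0 k) j * R.h1 k j) := fun j => by
    rw [← (R.step2_correction k).linearized j]
    ring
  simp only [inner_g0_d1_eq, hlin, Finset.sum_apply, Finset.sum_add_distrib, Finset.mul_sum]
  ring_nf

theorem isLittleO_obj_model (h : R.Bounded a M) (hx : Tendsto R.x atTop (𝓝 z))
    (hdm : (fun k => P.hessL z lam (R.d0 k) - matVec (R.B k) (R.d0 k)) =o[atTop] R.d0) :
    (fun k => P.obj (R.x k + (R.d0 k + R.d1 k)) - P.obj (R.x k) -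
      P.qpObj (R.x k) (R.B k) (R.d0 k)) =o[atTop] R.residual s := by
  refine (((h.isLittleO_obj_direction hobj hcon hs hsσ hx).add
    (h.isLittleO_inner_g0_d1 hobj hcon hs hsσ hlam hx)).add
    ((isLittleO_inner_model_error hdm).const_mul_left (1 / 2))).congr_left fun k => ?_
  simp only [qpObj, hessL_apply hobj hcon, inner_sub_right, inner_add_right, inner_sum,
    real_inner_smul_right]
  ring

end Run.Bounded

end ObjectiveExpansion

section UnitStep

namespace Run.Bounded

variable (hobj : ContDiff ℝ 2 P.obj) (hcon : ∀ j, ContDiff ℝ 2 (P.con j))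
  (hlam : ∀ j, Tendsto (fun k => R.lam k j) atTop (𝓝 (lam j)))

include hobj hcon hlam

theorem eventually_objective_decrease (h : R.Bounded a M) (hx : Tendsto R.x atTop (𝓝 z))
    (hdm : (fun k => P.hessL z lam (R.d0 k) - matVec (R.B k) (R.d0 k)) =o[atTop] R.d0) :
    ∀ᶠ k in atTop, P.obj (R.x k + (R.d0 k + R.d1 k)) ≤ P.obj (R.x k) +
      A.alpha * inner ℝ (P.g0 (R.x k)) (R.d0 k) +
      A.rho * (1 - A.alpha) * P.phi (R.x k) ^ A.theta := by
  have hα : 0 < 1 / 2 - A.alpha := sub_pos.2 A.alpha_mem.2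
  have hα1 : 0 < 1 - A.alpha := by linarith
  have hcoef : 0 < A.rho * (1 - A.alpha) := mul_pos (one_pos.trans A.one_lt_rho) hα1
  filter_upwards [(h.isLittleO_obj_model hobj hcon A.theta_pos.le A.theta_lt_sigma hlam hx
    hdm).bound (lt_min (mul_pos hα h.a_pos) hcoef)] with k hk
  rw [Real.norm_of_nonneg (R.residual_nonneg _ _), residual, mul_add] at hk
  have hmodel := (le_abs_self _).trans hk
  rw [qpObj] at hmodel
  have hd0 := mul_le_mul_of_nonneg_right
    (min_le_left ((1 / 2 - A.alpha) * a) (A.rho * (1 - A.alpha))) (sq_nonneg ‖R.d0 k‖)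
  have hφ := mul_le_mul_of_nonneg_right
    (min_le_right ((1 / 2 - A.alpha) * a) (A.rho * (1 - A.alpha)))
    (rpow_phi_nonneg (P := P) (R.x k) A.theta)
  have hdescent := mul_le_mul_of_nonneg_left (R.step1_multiplier k).inner_g0_le hα1.le
  have hcurv := mul_le_mul_of_nonneg_left (h.coercive k (R.d0 k)) hα.le
  linarith

theorem eventually_step3Conditions (h : R.Bounded a M) (hx : Tendsto R.x atTop (𝓝 z))
    (hdm : (fun k => P.hessL z lam (R.d0 k) - matVec (R.B k) (R.d0 k)) =o[atTop] R.d0) :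
    ∀ᶠ k in atTop, P.Step3Conditions A (R.x k) (R.d0 k) (R.d0 k + R.d1 k) 1 := by
  filter_upwards [h.eventually_objective_decrease hobj hcon hlam hx hdm,
    h.eventually_constraint_decrease hobj hcon] with k hobjective hconstraint
  refine ⟨?_, fun j hj => ?_, fun j hj => ?_⟩
  · rwa [one_smul, mul_one, mul_one]
  · rw [one_smul, mul_one]
    exact (hconstraint j).trans_eq (by rw [con_sub_fbar_of_pos hj])
  · have hdec : 0 ≤ A.alpha * (‖R.d0 k‖ ^ A.tau + P.phi (R.x k) ^ A.sigma) :=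
      mul_nonneg A.alpha_mem.1.le
        (add_nonneg (Real.rpow_nonneg (norm_nonneg _) _) (rpow_phi_nonneg _ _))
    rw [one_smul]
    linarith [hconstraint j, con_sub_fbar_of_nonpos hj]

end Run.Bounded

variable {x d0 d : EuclideanSpace ℝ (Fin n)}

theorem Step3Succeeds.eq_one {t : ℝ} (h : P.Step3Succeeds A x d0 d t)
    (hone : P.Step3Conditions A x d0 d 1) : t = 1 := by
  obtain ⟨i, rfl, -, -, hmin⟩ := h
  rcases i.eq_zero_or_pos with rfl | hi
  · exact pow_zero _
  · exact absurd (by rwa [pow_zero]) (hmin 0 hi)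

theorem Step3Conditions.not_step3Fails (h : P.Step3Conditions A x d0 d 1) :
    ¬ P.Step3Fails A x d0 d := fun hfails =>
  hfails 0 (by simpa using A.eps_mem.2.le) (by rwa [pow_zero])

end UnitStep

end NLProblem

theorem theorem3 {n m : ℕ} (P : NLProblem n m) (A : AlgParams) (R : P.Run A)
    (hindep : P.GradientsIndependent)
    (hB : ∃ a b : ℝ, 0 < a ∧ 0 < b ∧ ∀ (k : ℕ) (d : EuclideanSpace ℝ (Fin n)),
      a * ‖d‖ ^ 2 ≤ inner ℝ d (matVec (R.B k) d) ∧
      inner ℝ d (matVec (R.B k) d) ≤ b * ‖d‖ ^ 2)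
    (hobj : ContDiff ℝ 2 P.obj) (hcon : ∀ j, ContDiff ℝ 2 (P.con j))
    (hbdd : Bornology.IsBounded (Set.range R.x))
    (xstar : EuclideanSpace ℝ (Fin n)) (hacc : MapClusterPt xstar atTop R.x)
    (hssosc : ∀ lam : Fin m → ℝ, P.IsKKTPair xstar lam → P.StrongSecondOrder xstar lam)
    (hdm : ∀ lam : Fin m → ℝ, P.IsKKTPair xstar lam →
      (fun k => P.hessL xstar lam (R.d0 k) - matVec (R.B k) (R.d0 k)) =o[atTop] R.d0) :
    ∀ᶠ k in atTop,
      P.Step3Conditions A (R.x k) (R.d0 k) (R.d0 k + R.d1 k) 1 ∧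
      R.trace k = [1, 2, 3, 6] ∧
      R.t k = 1 ∧
      R.x (k + 1) = R.x k + (R.d0 k + R.d1 k) ∧
      qpCount (R.trace k) = 1 ∧
      sleCount (R.trace k) = 1 := by
  obtain ⟨a, b, ha, hb, hab⟩ := hB
  obtain ⟨M, hM⟩ := R.exists_bounded hindep ha hb.le hab hobj hcon hbdd
  obtain ⟨lam, hkkt⟩ := hM.exists_isKKTPair hindep hobj hcon hacc
  have hx := hM.tendsto_x hindep hobj hcon hacc hkkt (hssosc lam hkkt)
  have hlam := hM.tendsto_lam hindep hobj hcon hkkt hx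
  filter_upwards [hM.eventually_step3Conditions hobj hcon hlam hx (hdm lam hkkt),
    hM.eventually_step2Test hobj hcon] with k hcond htest
  rcases (R.iteration k).trace_or_steps45 with ⟨htrace, hdir, hsucceeds⟩ | ⟨-, hfail⟩
  · have ht := hsucceeds.eq_one hcond
    refine ⟨hcond, htrace, ht, ?_, ?_, ?_⟩
    · rw [R.step6_update k, ht, hdir, one_smul]
    · rw [htrace]; rfl
    · rw [htrace]; rfl
  · exact absurd hfail (not_or.2 ⟨not_not.2 htest, hcond.not_step3Fails⟩)
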